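/- Let $K=L^2((0,\infty);dt)$ (complex-valued functions) and let $\mathcal F_+$ be the cosine transform on $K$, the $L^2$-extension of $\mathcal F_+(f)(u)=2\int_0^\infty\cos(2\pi tu)f(t)\,dt$. For $a>0$ let the Sonine space $K_a$ be the closed subspace of those $f\in K$ such that $f$ and $\mathcal F_+(f)$ both vanish almost everywhere on $(0,a)$. For $f\in K_a$ the function $\pi^{-s/2}\Gamma(\tfrac s2)\int_0^\infty f(t)t^{-s}\,dt$, $\Re(s)>\tfrac12$, extends to an entire function $M(f)$; for $w\in\mathbb C$ and $k\in\mathbb N=\{0,1,2,\dots\}$ the evaluator $Z^a_{w,k}\in K_a$ is the vector such that $\int_0^\infty f(t)Z^a_{w,k}(t)\,dt=M(f)^{(k)}(w)$ for all $f\in K_a$. An indexed family of vectors in a Hilbert space is called minimal if none of its vectors lies in the closed linear span of the others, and complete if its linear span is dense. Let $\mathcal Z$ be a non-empty multiset of complex numbers, i.e. a non-empty countable set of complex numbers $w$, each with a finite multiplicity $m_w\ge1$ (accumulation points are allowed). The evaluators associated to $\mathcal Z$ in $K_a$ are the vectors $Z^a_{w,k}$, $w\in\mathcal Z$, $0\le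 k<m_w$. Let $a_1(\mathcal Z)\in[0,+\infty]$ be the supremum of the $a>0$ for which these evaluators are a minimal system in $K_a$ ($0$ if there is none), and let $a_2(\mathcal Z)\in[0,+\infty]$ be the infimum of the $a>0$ for which they are a complete system in $K_a$ ($+\infty$ if there is none). Then $a_1(\mathcal Z)=a_2(\mathcal Z)$. Denote this common value by $a(\mathcal Z)$. If $0<a<a(\mathcal Z)$, then for every finite set $S\subset\mathbb C\times\mathbb N$ the system of evaluators $Z^a_{w,k}$ indexed by the pairs $(w,k)$ with $w\in\mathcal Z$, $0\le k<m_w$, or $(w,k)\in S$, is minimal and not complete in $K_a$. -/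

import Mathlib

open MeasureTheory Set
open scoped ENNReal FourierTransform

noncomputable section

/-- The Hilbert space `K = L²((0, ∞); dt)` of complex-valued functions. -/
abbrev HalfLineL2 : Type := Lp ℂ 2 (volume.restrict (Ioi (0 : ℝ)))

theorem map_abs_volume_le :
    Measure.map (fun x : ℝ => |x|) volume ≤ (2 : ℝ≥0∞) • volume.restrict (Ioi (0 : ℝ)) := by
  refine Measure.le_iff.2 fun s hs => ?_
  rw [Measure.map_apply continuous_abs.measurable hs, Measure.smul_apply, Measure.restrict_apply hs]
  have hsub : (fun x : ℝ => |x|) ⁻¹' s ⊆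
      {0} ∪ ((s ∩ Ioi 0) ∪ Neg.neg ⁻¹' (s ∩ Ioi (0 : ℝ))) := by
    intro x hx
    rcases lt_trichotomy x 0 with h | h | h
    · right; right
      refine ⟨?_, by simpa using h⟩
      simpa [abs_of_neg h] using hx
    · left; exact h
    · right; left
      exact ⟨by simpa [abs_of_pos h] using hx, h⟩
  calc volume ((fun x : ℝ => |x|) ⁻¹' s)
      ≤ volume ({0} ∪ ((s ∩ Ioi 0) ∪ Neg.neg ⁻¹' (s ∩ Ioi (0 : ℝ)))) := measure_mono hsub
    _ ≤ volume {(0 : ℝ)} + (volume (s ∩ Ioi 0) + volume (Neg.neg ⁻¹' (s ∩ Ioi (0 : ℝ)))) :=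
        (measure_union_le _ _).trans (by gcongr; exact measure_union_le _ _)
    _ = (2 : ℝ≥0∞) • volume (s ∩ Ioi 0) := by
        rw [Measure.measure_preimage_neg]
        simp [two_mul]

theorem memLp_comp_abs (f : HalfLineL2) : MemLp (fun x : ℝ => f |x|) 2 volume :=
  (((Lp.memLp f).smul_measure ENNReal.ofNat_ne_top).mono_measure map_abs_volume_le).comp_of_map
    continuous_abs.measurable.aemeasurable

theorem ae_comp_abs {p : ℝ → Prop} (h : ∀ᵐ t ∂volume.restrict (Ioi (0 : ℝ)), p t) :
    ∀ᵐ x : ℝ, p |x| :=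
  ae_of_ae_map continuous_abs.measurable.aemeasurable
    (((Measure.absolutelyContinuous_of_le map_abs_volume_le).trans
      (Measure.smul_absolutelyContinuous)).ae_le h)

/-- The even extension of `f ∈ L²(0, ∞)` to the real line, `x ↦ f |x|`, as an element
of `L²(ℝ)`. -/
def evenExtension : HalfLineL2 →ₗ[ℂ] Lp ℂ 2 (volume : Measure ℝ) where
  toFun f := (memLp_comp_abs f).toLp (fun x => f |x|)
  map_add' f g := by
    rw [← MemLp.toLp_add, MemLp.toLp_eq_toLp_iff]
    exact ae_comp_abs (Lp.coeFn_add f g)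
  map_smul' c f := by
    rw [RingHom.id_apply, ← MemLp.toLp_const_smul, MemLp.toLp_eq_toLp_iff]
    exact ae_comp_abs (Lp.coeFn_smul c f)

/-- The cosine transform on `L²(0, ∞)`, i.e. the `L²`-extension of
`f ↦ (u ↦ 2 ∫_0^∞ cos (2 π t u) f t dt)`: the restriction to `(0, ∞)` of the Plancherel-Fourier
transform (with kernel `exp (-2 π i x y)`) of the even extension of `f`. -/
def cosineTransform : HalfLineL2 →ₗ[ℂ] HalfLineL2 where
  toFun f := LpToLpRestrictCLM ℝ ℂ ℂ volume 2 (Ioi 0) (𝓕 (evenExtension f))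
  map_add' f g := by rw [map_add, FourierTransform.fourier_add, map_add]
  map_smul' c f := by
    rw [map_smul, FourierTransform.fourier_smul, map_smul, RingHom.id_apply]

/-- The subspace of `L²(0, ∞)` of functions vanishing almost everywhere on `(0, a)`. -/
def vanishingBelow (a : ℝ) : Submodule ℂ HalfLineL2 where
  carrier := {f | ∀ᵐ t ∂volume.restrict (Ioi (0 : ℝ)), t < a → f t = 0}
  zero_mem' := by
    filter_upwards [Lp.coeFn_zero ℂ 2 (volume.restrict (Ioi (0 : ℝ)))] with t ht _
    exact ht
  add_mem' := by
    intro f g hf hg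
    filter_upwards [hf, hg, Lp.coeFn_add f g] with t h1 h2 h3 hta
    rw [h3, Pi.add_apply, h1 hta, h2 hta, add_zero]
  smul_mem' := by
    intro c f hf
    filter_upwards [hf, Lp.coeFn_smul c f] with t h1 h2 hta
    rw [h2, Pi.smul_apply, h1 hta, smul_zero]

/-- The Sonine space `K_a`: the functions in `L²(0, ∞)` which vanish on `(0, a)` and whose cosine
transform vanishes on `(0, a)`. -/
def sonineSpace (a : ℝ) : Submodule ℂ HalfLineL2 :=
  vanishingBelow a ⊓ (vanishingBelow a).comap cosineTransform

/-- The right Mellin transform `∫_0^∞ f(t) t^{-s} dt`, as a Lebesgue integral. -/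
def rightMellin (f : HalfLineL2) (s : ℂ) : ℂ :=
  ∫ t in Ioi (0 : ℝ), f t * (t : ℂ) ^ (-s)

/-- `F` is an entire function which is the analytic continuation of
`π^{-s/2} Γ(s/2) ∫_0^∞ f(t) t^{-s} dt`; for `f` vanishing near `0` the integral converges
absolutely on `Re s > 1/2`. -/
def IsCompletedMellin (f : HalfLineL2) (F : ℂ → ℂ) : Prop :=
  Differentiable ℂ F ∧ ∀ s : ℂ, 1 / 2 < s.re →
    F s = (Real.pi : ℂ) ^ (-s / 2) * Complex.Gamma (s / 2) * rightMellin f s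

open Classical in
/-- The completed right Mellin transform `M(f)`, for `f` in a Sonine space: the entire function
continuing `π^{-s/2} Γ(s/2) ∫_0^∞ f(t) t^{-s} dt`, which is unique when it exists. (The value is
`0` by convention if there is no such function.) -/
def completedMellin (f : HalfLineL2) : ℂ → ℂ :=
  if h : ∃ F, IsCompletedMellin f F then h.choose else 0

/-- The vector `Z ∈ K_a` represents the evaluation `f ↦ M(f)^{(k)}(w)` on `K_a`, with respect to
the bilinear form `[f, g] = ∫_0^∞ f(t) g(t) dt`. -/
def IsEvaluator (a : ℝ) (w : ℂ) (k : ℕ) (Z : sonineSpace a) : Prop :=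
  ∀ f : sonineSpace a,
    ∫ t in Ioi (0 : ℝ), (f : HalfLineL2) t * (Z : HalfLineL2) t
      = iteratedDeriv k (completedMellin (f : HalfLineL2)) w

open Classical in
/-- The evaluator `Z^a_{w,k} ∈ K_a`, which is unique when it exists. (The value is `0` by
convention if there is none.) -/
def evaluator (a : ℝ) (w : ℂ) (k : ℕ) : sonineSpace a :=
  if h : ∃ Z, IsEvaluator a w k Z then h.choose else 0

/-- An indexed collection of vectors is minimal if none of them is in the closed linear span of
the others. -/
def IsMinimalSystem {ι E : Type*} [NormedAddCommGroup E] [NormedSpace ℂ E] (u : ι → E) : Prop :=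
  ∀ i, u i ∉ closure (Submodule.span ℂ (u '' {j | j ≠ i}) : Set E)

/-- An indexed collection of vectors is complete if its linear span is dense. -/
def IsCompleteSystem {ι E : Type*} [NormedAddCommGroup E] [NormedSpace ℂ E] (u : ι → E) : Prop :=
  Dense (Submodule.span ℂ (range u) : Set E)

/-- The collection of the evaluators `Z^a_{w,k}` in `K_a`, for `(w, k)` in a given set `I`. -/
def evaluatorSystem (a : ℝ) (I : Set (ℂ × ℕ)) : I → sonineSpace a :=
  fun p => evaluator a p.1.1 p.1.2

/-- A multiset of complex numbers is given by its multiplicity function `m : ℂ → ℕ`. The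
evaluators associated to it are the `Z^a_{w,k}` with `0 ≤ k < m w`; this is their index set. -/
def multisetIndices (m : ℂ → ℕ) : Set (ℂ × ℕ) := {p | p.2 < m p.1}

/-- The index `a₁ ∈ [0, ∞]` of a multiset: the supremum of the `a > 0` for which the associated
evaluators are a minimal system in `K_a`. -/
def minimalityIndex (m : ℂ → ℕ) : ℝ≥0∞ :=
  sSup (ENNReal.ofReal '' {a | 0 < a ∧ IsMinimalSystem (evaluatorSystem a (multisetIndices m))})

/-- The index `a₂ ∈ [0, ∞]` of a multiset: the infimum of the `a > 0` for which the associated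
evaluators are a complete system in `K_a`. -/
def completenessIndex (m : ℂ → ℕ) : ℝ≥0∞ :=
  sInf (ENNReal.ofReal '' {a | 0 < a ∧ IsCompleteSystem (evaluatorSystem a (multisetIndices m))})

end

noncomputable section

open Filter Topology SchwartzMap

theorem lpPairing_mul_apply {α : Type*} [MeasurableSpace α] {μ : Measure α} (f g : Lp ℂ 2 μ) :
    (ContinuousLinearMap.mul ℂ ℂ).lpPairing μ 2 2 f g = ∫ x, f x * g x ∂μ := by
  rw [ContinuousLinearMap.lpPairing_eq_integral]; rfl

theorem integrable_mul_of_lp_two {α : Type*} [MeasurableSpace α] {μ : Measure α}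
    (f g : Lp ℂ 2 μ) : Integrable (fun x => f x * g x) μ :=
  (Lp.memLp f).integrable_mul (Lp.memLp g)

theorem integral_fourier_mul_schwartz (f : Lp ℂ 2 (volume : Measure ℝ)) (g : 𝓢(ℝ, ℂ)) :
    ∫ x, (𝓕 f : Lp ℂ 2 (volume : Measure ℝ)) x * g x = ∫ x, f x * 𝓕 (g : ℝ → ℂ) x := by
  have h := congrArg (fun T => T g) (Lp.fourier_toTemperedDistribution_eq f)
  simp only [TemperedDistribution.fourier_apply, Lp.toTemperedDistribution_apply,
    smul_eq_mul] at h
  simp_rw [mul_comm _ (g _)]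
  rw [← h]
  refine integral_congr_ae (ae_of_all _ fun x => ?_)
  simp only [mul_comm (f x), SchwartzMap.fourier_coe]

/-- The multiplication formula for the Fourier transform on `L²(ℝ)`. -/
theorem integral_fourier_mul_eq (f g : Lp ℂ 2 (volume : Measure ℝ)) :
    ∫ x, (𝓕 f : Lp ℂ 2 (volume : Measure ℝ)) x * g x
      = ∫ x, f x * (𝓕 g : Lp ℂ 2 (volume : Measure ℝ)) x := by
  simp_rw [← lpPairing_mul_apply]
  refine DenseRange.induction_on (SchwartzMap.denseRange_toLpCLM (F := ℂ) (E := ℝ) (p := 2)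
    ENNReal.ofNat_ne_top) g (isClosed_eq (by fun_prop) ?_) fun φ => ?_
  · exact ((ContinuousLinearMap.mul ℂ ℂ).lpPairing volume 2 2 f).continuous.comp
      (FourierTransform.continuous_fourier)
  · simp_rw [lpPairing_mul_apply, SchwartzMap.toLpCLM_apply, SchwartzMap.toLp_fourier_eq]
    refine Eq.trans ?_ ((integral_fourier_mul_schwartz f φ).trans ?_)
    · refine integral_congr_ae ?_
      filter_upwards [φ.coeFn_toLp 2 volume] with x hx
      rw [hx]
    · refine integral_congr_ae ?_
      filter_upwards [(𝓕 φ).coeFn_toLp 2 volume] with x hx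
      rw [hx, SchwartzMap.fourier_coe]

theorem ae_eq_of_forall_integral_mul_schwartz {f g : ℝ → ℂ} (hf : MemLp f 2 volume)
    (hg : MemLp g 2 volume) (h : ∀ φ : 𝓢(ℝ, ℂ), ∫ x, f x * φ x = ∫ x, g x * φ x) :
    f =ᵐ[volume] g := by
  rw [← MemLp.toLp_eq_toLp_iff hf hg, ← sub_eq_zero]
  have hk := Lp.ker_toTemperedDistributionCLM_eq_bot (F := ℂ) (E := ℝ) (μ := volume) (p := 2)
  rw [LinearMap.ker_eq_bot'] at hk
  refine hk _ ?_
  ext φ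
  rw [ContinuousLinearMap.coe_coe, map_sub]
  simp only [Lp.toTemperedDistributionCLM_apply]
  change Lp.toTemperedDistribution (hf.toLp f) φ - Lp.toTemperedDistribution (hg.toLp g) φ = 0
  rw [Lp.toTemperedDistribution_apply, Lp.toTemperedDistribution_apply, sub_eq_zero]
  refine Eq.trans ?_ ((h φ).trans ?_)
  · refine integral_congr_ae ?_
    filter_upwards [hf.coeFn_toLp] with x hx
    simp [hx, mul_comm]
  · refine integral_congr_ae ?_
    filter_upwards [hg.coeFn_toLp] with x hx
    simp [hx, mul_comm]

/-- The Fourier transform of an even function in `L²(ℝ)` is even. -/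
theorem fourier_ae_even {f : Lp ℂ 2 (volume : Measure ℝ)} (hf : ∀ᵐ x, f (-x) = f x) :
    ∀ᵐ x, (𝓕 f : Lp ℂ 2 (volume : Measure ℝ)) (-x) = (𝓕 f : Lp ℂ 2 (volume : Measure ℝ)) x := by
  have hL := Lp.memLp (𝓕 f : Lp ℂ 2 (volume : Measure ℝ))
  refine ae_eq_of_forall_integral_mul_schwartz
    (hL.comp_measurePreserving (Measure.measurePreserving_neg volume)) hL fun φ => ?_
  let ψ : 𝓢(ℝ, ℂ) := SchwartzMap.compCLMOfContinuousLinearEquiv ℂ (ContinuousLinearEquiv.neg ℝ) φ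
  have hψ : (ψ : ℝ → ℂ) = φ ∘ (LinearIsometryEquiv.neg ℝ : ℝ ≃ₗᵢ[ℝ] ℝ) := rfl
  calc ∫ x, (𝓕 f : Lp ℂ 2 (volume : Measure ℝ)) (-x) * φ x
      = ∫ x, (𝓕 f : Lp ℂ 2 (volume : Measure ℝ)) x * ψ x := by
        rw [← integral_neg_eq_self]
        simp [hψ]
    _ = ∫ x, f x * 𝓕 (φ : ℝ → ℂ) (-x) := by
        rw [integral_fourier_mul_schwartz, hψ]
        simp_rw [Real.fourier_comp_linearIsometry]
        simp
    _ = ∫ x, f x * 𝓕 (φ : ℝ → ℂ) x := by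
        rw [← integral_neg_eq_self]
        refine integral_congr_ae ?_
        filter_upwards [hf] with x hx
        simp [hx]
    _ = _ := (integral_fourier_mul_schwartz f φ).symm

/-- On `L¹ ∩ L²` the Plancherel-Fourier transform is given by the Fourier integral. -/
theorem fourier_toLp_ae_eq {f : ℝ → ℂ} (hf : MemLp f 2 volume) (h1 : Integrable f)
    (hF : MemLp (𝓕 f) 2 volume) : 𝓕 (hf.toLp f) = hF.toLp (𝓕 f) := by
  have hL := Lp.memLp (𝓕 (hf.toLp f) : Lp ℂ 2 (volume : Measure ℝ))
  have : ⇑(𝓕 (hf.toLp f) : Lp ℂ 2 (volume : Measure ℝ)) =ᵐ[volume] 𝓕 f := by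
    refine ae_eq_of_forall_integral_mul_schwartz hL hF fun φ => ?_
    rw [integral_fourier_mul_schwartz]
    have h := VectorFourier.integral_fourierIntegral_smul_eq_flip (μ := volume) (ν := volume)
      (L := innerₗ ℝ) Real.continuous_fourierChar
      continuous_inner h1 (φ.integrable (μ := volume))
    simp only [smul_eq_mul, flip_innerₗ] at h
    refine Eq.trans ?_ h.symm
    refine integral_congr_ae ?_
    filter_upwards [hf.coeFn_toLp] with x hx
    rw [hx]; rfl
  ext1
  exact this.trans hF.coeFn_toLp.symm

theorem evenExtension_coeFn (f : HalfLineL2) : ⇑(evenExtension f) =ᵐ[volume] fun x => f |x| :=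
  (memLp_comp_abs f).coeFn_toLp

theorem cosineTransform_coeFn (f : HalfLineL2) :
    ⇑(cosineTransform f) =ᵐ[volume.restrict (Ioi (0 : ℝ))]
      (𝓕 (evenExtension f) : Lp ℂ 2 (volume : Measure ℝ)) :=
  LpToLpRestrictCLM_coeFn ℂ (Ioi (0 : ℝ)) _

theorem evenExtension_ae_even (f : HalfLineL2) :
    ∀ᵐ x : ℝ, evenExtension f (-x) = evenExtension f x := by
  have h := evenExtension_coeFn f
  filter_upwards [h, (Measure.measurePreserving_neg (volume : Measure ℝ)).quasiMeasurePreserving.ae h] with x h1 h2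
  rw [h1, h2, abs_neg]

theorem evenExtension_cosineTransform (f : HalfLineL2) :
    evenExtension (cosineTransform f) = 𝓕 (evenExtension f) := by
  ext1
  refine (evenExtension_coeFn _).trans ?_
  filter_upwards [ae_comp_abs (cosineTransform_coeFn f),
    fourier_ae_even (evenExtension_ae_even f)] with x h1 h2
  rw [h1]
  rcases abs_cases x with h | h
  · rw [h.1]
  · rw [h.1, h2]

theorem integral_comp_abs_complex {h : ℝ → ℂ} (hi : Integrable fun x : ℝ => h |x|) :
    ∫ x : ℝ, h |x| = 2 * ∫ t in Ioi (0 : ℝ), h t := by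
  have h1 : ∫ x in Ioi (0 : ℝ), h |x| = ∫ t in Ioi (0 : ℝ), h t :=
    setIntegral_congr_fun measurableSet_Ioi fun x hx => by
      simp only [abs_of_pos (mem_Ioi.1 hx)]
  have h2 : ∫ x in Iic (0 : ℝ), h |x| = ∫ t in Ioi (0 : ℝ), h t := by
    rw [← h1]
    have := integral_comp_neg_Iic (0 : ℝ) fun x => h |x|
    simpa using this
  rw [← setIntegral_univ, ← Iic_union_Ioi (a := (0 : ℝ)),
    setIntegral_union (Iic_disjoint_Ioi le_rfl) measurableSet_Ioi hi.integrableOn hi.integrableOn,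
    h1, h2, two_mul]

theorem integral_evenExtension_mul (f g : HalfLineL2) :
    ∫ x, evenExtension f x * evenExtension g x = 2 * ∫ t in Ioi (0 : ℝ), f t * g t := by
  have h : (fun x => evenExtension f x * evenExtension g x)
      =ᵐ[volume] fun x : ℝ => f |x| * g |x| := by
    filter_upwards [evenExtension_coeFn f, evenExtension_coeFn g] with x h1 h2
    rw [h1, h2]
  rw [integral_congr_ae h, integral_comp_abs_complex (h := fun t => f t * g t)]
  exact (integrable_mul_of_lp_two _ _).congr h

/-- The cosine transform is symmetric for the bilinear form `∫ f g`. -/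
theorem integral_cosineTransform_mul (f g : HalfLineL2) :
    ∫ t in Ioi (0 : ℝ), cosineTransform f t * g t
      = ∫ t in Ioi (0 : ℝ), f t * cosineTransform g t := by
  have h := integral_fourier_mul_eq (evenExtension f) (evenExtension g)
  rw [← evenExtension_cosineTransform, ← evenExtension_cosineTransform,
    integral_evenExtension_mul, integral_evenExtension_mul] at h
  exact mul_left_cancel₀ two_ne_zero h

theorem exists_norm_cosineTransform_le :
    ∃ C : ℝ, 0 ≤ C ∧ ∀ f : HalfLineL2, ‖cosineTransform f‖ ≤ C * ‖f‖ := by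
  refine ⟨((2 : ℝ≥0∞) ^ (1 / (2 : ℝ≥0∞)).toReal).toReal, ENNReal.toReal_nonneg, fun f => ?_⟩
  have h1 : ‖cosineTransform f‖ ≤ ‖evenExtension f‖ := by
    rw [← Lp.norm_fourier_eq (evenExtension f)]
    exact norm_Lp_toLp_restrict_le _ _
  refine h1.trans ?_
  change ‖(memLp_comp_abs f).toLp (fun x => f |x|)‖ ≤ _
  rw [Lp.norm_toLp, Lp.norm_def, ← ENNReal.toReal_mul]
  refine ENNReal.toReal_mono (ENNReal.mul_ne_top (by simp) (Lp.eLpNorm_ne_top f)) ?_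
  have hm : AEStronglyMeasurable f (Measure.map (fun x : ℝ => |x|) volume) :=
    ((Lp.aestronglyMeasurable f).smul_measure 2).mono_measure map_abs_volume_le
  have := eLpNorm_map_measure (p := 2) hm continuous_abs.measurable.aemeasurable
  change eLpNorm (f ∘ fun x : ℝ => |x|) 2 volume ≤ _
  rw [← this]
  refine (eLpNorm_mono_measure _ map_abs_volume_le).trans ?_
  rw [eLpNorm_smul_measure_of_ne_top (by simp)]
  simp

theorem integrable_gaussian {u : ℝ} (hu : 0 < u) :
    Integrable fun t : ℝ => Real.exp (-Real.pi * u * t ^ 2) := by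
  have := integrable_exp_neg_mul_sq (mul_pos Real.pi_pos hu)
  simpa [neg_mul] using this

theorem memLp_gaussian {u : ℝ} (hu : 0 < u) :
    MemLp (fun t : ℝ => (Real.exp (-Real.pi * u * t ^ 2) : ℂ)) 2 volume := by
  suffices h : MemLp (fun t : ℝ => Real.exp (-Real.pi * u * t ^ 2)) 2 volume from h.ofReal
  rw [memLp_two_iff_integrable_sq (by fun_prop)]
  refine (integrable_gaussian (mul_pos two_pos hu)).congr (ae_of_all _ fun t => ?_)
  simp only [← Real.exp_nat_mul]
  congr 1
  push_cast
  ring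

/-- The Gaussian `t ↦ exp (-π u t²)` as an element of `L²(0, ∞)`. -/
def gaussian (u : ℝ) (hu : 0 < u) : HalfLineL2 := ((memLp_gaussian hu).restrict _).toLp _

theorem gaussian_coeFn {u : ℝ} (hu : 0 < u) :
    ⇑(gaussian u hu) =ᵐ[volume.restrict (Ioi (0 : ℝ))]
      fun t => (Real.exp (-Real.pi * u * t ^ 2) : ℂ) :=
  ((memLp_gaussian hu).restrict _).coeFn_toLp

theorem fourier_gaussian_real {u : ℝ} (hu : 0 < u) :
    𝓕 (fun t : ℝ => (Real.exp (-Real.pi * u * t ^ 2) : ℂ))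
      = fun t : ℝ => ((u ^ (-(1 / 2) : ℝ) : ℝ) : ℂ) *
          (Real.exp (-Real.pi * u⁻¹ * t ^ 2) : ℂ) := by
  have h := fourier_gaussian_pi (b := (u : ℂ)) (by simpa using hu)
  have h2 : (fun t : ℝ => (Real.exp (-Real.pi * u * t ^ 2) : ℂ))
      = fun t : ℝ => Complex.exp (-Real.pi * u * t ^ 2) := by
    funext t; push_cast; rfl
  rw [h2, h]
  funext t
  rw [Real.rpow_neg hu.le, Complex.ofReal_inv, Complex.ofReal_cpow hu.le, one_div]
  push_cast
  simp [div_eq_mul_inv]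

theorem cosineTransform_gaussian {u : ℝ} (hu : 0 < u) :
    cosineTransform (gaussian u hu)
      = ((u ^ (-(1 / 2) : ℝ) : ℝ) : ℂ) • gaussian u⁻¹ (inv_pos.2 hu) := by
  have he : evenExtension (gaussian u hu) = (memLp_gaussian hu).toLp _ := by
    ext1
    refine (evenExtension_coeFn _).trans ?_
    filter_upwards [ae_comp_abs (gaussian_coeFn hu), (memLp_gaussian hu).coeFn_toLp] with x h1 h2
    rw [h1, h2, sq_abs]
  have hF : MemLp (𝓕 (fun t : ℝ => (Real.exp (-Real.pi * u * t ^ 2) : ℂ))) 2 volume := by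
    rw [fourier_gaussian_real hu]
    exact (memLp_gaussian (inv_pos.2 hu)).const_mul _
  have hfou := fourier_toLp_ae_eq (memLp_gaussian hu) (integrable_gaussian hu).ofReal hF
  ext1
  refine (cosineTransform_coeFn _).trans ?_
  rw [he, hfou]
  filter_upwards [ae_restrict_of_ae hF.coeFn_toLp, gaussian_coeFn (inv_pos.2 hu),
    Lp.coeFn_smul ((u ^ (-(1 / 2) : ℝ) : ℝ) : ℂ) (gaussian u⁻¹ (inv_pos.2 hu))] with t h1 h2 h3
  rw [h1, h3, Pi.smul_apply, h2, fourier_gaussian_real hu, smul_eq_mul]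

/-- The theta function `u ↦ ∫_0^∞ f(t) exp (-π u t²) dt` of `f ∈ L²(0, ∞)`. -/
def theta (f : HalfLineL2) (u : ℝ) : ℂ :=
  ∫ t in Ioi (0 : ℝ), f t * (Real.exp (-Real.pi * u * t ^ 2) : ℂ)

theorem theta_eq_integral_mul_gaussian (f : HalfLineL2) {u : ℝ} (hu : 0 < u) :
    theta f u = ∫ t in Ioi (0 : ℝ), f t * gaussian u hu t := by
  refine integral_congr_ae ?_
  filter_upwards [gaussian_coeFn hu] with t ht
  rw [ht]

theorem integrable_mul_gaussian (f : HalfLineL2) {u : ℝ} (hu : 0 < u) :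
    IntegrableOn (fun t => f t * (Real.exp (-Real.pi * u * t ^ 2) : ℂ)) (Ioi (0 : ℝ)) := by
  refine (integrable_mul_of_lp_two f (gaussian u hu)).congr ?_
  filter_upwards [gaussian_coeFn hu] with t ht
  rw [ht]

theorem theta_cosineTransform (f : HalfLineL2) {u : ℝ} (hu : 0 < u) :
    theta (cosineTransform f) u = ((u ^ (-(1 / 2) : ℝ) : ℝ) : ℂ) * theta f u⁻¹ := by
  rw [theta_eq_integral_mul_gaussian _ hu, integral_cosineTransform_mul,
    cosineTransform_gaussian hu, theta_eq_integral_mul_gaussian _ (inv_pos.2 hu),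
    ← integral_const_mul]
  refine integral_congr_ae ?_
  filter_upwards [Lp.coeFn_smul ((u ^ (-(1 / 2) : ℝ) : ℝ) : ℂ)
    (gaussian u⁻¹ (inv_pos.2 hu))] with t h3
  rw [h3, Pi.smul_apply, smul_eq_mul]
  ring

theorem integral_mul_polynomial_eq_zero {α : Type*} [MeasurableSpace α] {μ : Measure α}
    {h : α → ℂ} {x : α → ℝ} (hint : ∀ n : ℕ, Integrable (fun t => h t * ((x t) ^ n : ℝ)) μ)
    (hz : ∀ n : ℕ, ∫ t, h t * ((x t) ^ n : ℝ) ∂μ = 0) (p : Polynomial ℝ) :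
    Integrable (fun t => h t * (p.eval (x t) : ℝ)) μ ∧ ∫ t, h t * (p.eval (x t) : ℝ) ∂μ = 0 := by
  induction p using Polynomial.induction_on' with
  | add p q hp hq =>
    simp only [Polynomial.eval_add, Complex.ofReal_add, mul_add]
    exact ⟨hp.1.add hq.1, by rw [integral_add hp.1 hq.1, hp.2, hq.2, add_zero]⟩
  | monomial n c =>
    have : ∀ t, h t * ((Polynomial.monomial n c).eval (x t) : ℝ)
        = c * (h t * ((x t) ^ n : ℝ)) := fun t => by
      rw [Polynomial.eval_monomial]; push_cast; ring
    simp only [this]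
    exact ⟨(hint n).const_mul _, by rw [integral_const_mul, hz, mul_zero]⟩

theorem integral_mul_continuousOn_eq_zero {α : Type*} [MeasurableSpace α] {μ : Measure α}
    {h : α → ℂ} {x : α → ℝ} (hx : ∀ t, x t ∈ Icc (0 : ℝ) 1)
    (hint : ∀ n : ℕ, Integrable (fun t => h t * ((x t) ^ n : ℝ)) μ)
    (hz : ∀ n : ℕ, ∫ t, h t * ((x t) ^ n : ℝ) ∂μ = 0) {q : ℝ → ℝ}
    (hq : ContinuousOn q (Icc 0 1)) (hqi : Integrable (fun t => h t * (q (x t) : ℝ)) μ) :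
    ∫ t, h t * (q (x t) : ℝ) ∂μ = 0 := by
  have hh : Integrable h μ := by simpa using hint 0
  by_contra hne
  have hpos : 0 < ‖∫ t, h t * (q (x t) : ℝ) ∂μ‖ := norm_pos_iff.2 hne
  have hI : 0 ≤ ∫ t, ‖h t‖ ∂μ := integral_nonneg fun _ => norm_nonneg _
  set c := ‖∫ t, h t * (q (x t) : ℝ) ∂μ‖
  obtain ⟨p, hp⟩ := exists_polynomial_near_of_continuousOn 0 1 q hq
    (c / (1 + ∫ t, ‖h t‖ ∂μ)) (by positivity)
  obtain ⟨hpi, hp0⟩ := integral_mul_polynomial_eq_zero hint hz p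
  have : c ≤ ∫ t, ‖h t‖ * (c / (1 + ∫ t, ‖h t‖ ∂μ)) ∂μ := by
    have h1 : ∫ t, h t * (q (x t) : ℝ) ∂μ
        = ∫ t, (h t * (q (x t) : ℝ) - h t * (p.eval (x t) : ℝ)) ∂μ := by
      rw [integral_sub hqi hpi, hp0, sub_zero]
    change ‖_‖ ≤ _
    rw [h1]
    refine norm_integral_le_of_norm_le (hh.norm.mul_const _) (ae_of_all _ fun t => ?_)
    rw [← mul_sub, norm_mul, ← Complex.ofReal_sub, Complex.norm_real, norm_sub_rev]
    gcongr
    exact (hp _ (hx t)).le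
  rw [integral_mul_const, mul_div_assoc', le_div_iff₀ (by positivity)] at this
  nlinarith

theorem continuousOn_comp_sqrt_log {φ : ℝ → ℝ} (hφ : Continuous φ) (hc : HasCompactSupport φ)
    (h0 : tsupport φ ⊆ Ioi 0) :
    ContinuousOn (fun x => φ (√(-Real.log x / Real.pi))) (Icc 0 1) := by
  intro x hx
  rcases hx.1.eq_or_lt with rfl | hx0
  · obtain ⟨R, hR⟩ := hc.isCompact.isBounded.subset_ball (0 : ℝ)
    have hφ0 : φ 0 = 0 := image_eq_zero_of_notMem_tsupport fun h => lt_irrefl (0 : ℝ) (h0 h)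
    have hev : (fun x => φ (√(-Real.log x / Real.pi))) =ᶠ[𝓝[Icc 0 1] 0] fun _ => 0 := by
      have : Iio (Real.exp (-(Real.pi * R ^ 2))) ∈ 𝓝[Icc (0 : ℝ) 1] 0 :=
        mem_nhdsWithin_of_mem_nhds (Iio_mem_nhds (Real.exp_pos _))
      filter_upwards [this, self_mem_nhdsWithin] with y hy hy1
      rcases hy1.1.eq_or_lt with rfl | hy0
      · simp [hφ0]
      · refine image_eq_zero_of_notMem_tsupport fun h => ?_
        have h2 := hR h
        rw [mem_ball_zero_iff, Real.norm_of_nonneg (Real.sqrt_nonneg _)] at h2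
        have hl : Real.log y < -(Real.pi * R ^ 2) := (Real.log_lt_iff_lt_exp hy0).2 hy
        have : R ^ 2 ≤ -Real.log y / Real.pi := by
          rw [le_div_iff₀ Real.pi_pos]; linarith
        have := Real.le_sqrt_of_sq_le this
        linarith
    refine ContinuousWithinAt.congr_of_eventuallyEq continuousWithinAt_const hev ?_
    simp [hφ0]
  · have := Real.continuousAt_log hx0.ne'
    exact (ContinuousAt.comp (g := φ) hφ.continuousAt (by fun_prop)).continuousWithinAt

/-- Gaussians are total in `L²(0, ∞)`. -/
theorem eq_zero_of_theta_eq_zero {f : HalfLineL2} (hf : ∀ u, 0 < u → theta f u = 0) : f = 0 := by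
  set h : ℝ → ℂ := fun t => f t * (Real.exp (-Real.pi * t ^ 2) : ℂ)
  have hpow : ∀ (n : ℕ) (t : ℝ), h t * ((Real.exp (-Real.pi * t ^ 2)) ^ n : ℝ)
      = f t * (Real.exp (-Real.pi * (n + 1 : ℝ) * t ^ 2) : ℂ) := fun n t => by
    simp only [h]
    rw [mul_assoc, ← Complex.ofReal_mul, ← Real.exp_nat_mul, ← Real.exp_add]
    congr 3
    ring
  have hn : ∀ n : ℕ, (0 : ℝ) < n + 1 := fun n => by positivity
  have hint : ∀ n : ℕ, IntegrableOn (fun t => h t * ((Real.exp (-Real.pi * t ^ 2)) ^ n : ℝ))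
      (Ioi (0 : ℝ)) := fun n => by
    simp only [hpow]
    exact integrable_mul_gaussian f (hn n)
  have hz : ∀ n : ℕ, ∫ t in Ioi (0 : ℝ), h t * ((Real.exp (-Real.pi * t ^ 2)) ^ n : ℝ) = 0 :=
    fun n => by
      simp only [hpow]
      exact hf _ (hn n)
  have hi : IntegrableOn h (Ioi (0 : ℝ)) := by simpa using hint 0
  have hx : ∀ t : ℝ, Real.exp (-Real.pi * t ^ 2) ∈ Icc (0 : ℝ) 1 := fun t =>
    ⟨(Real.exp_pos _).le, Real.exp_le_one_iff.2 (by nlinarith [Real.pi_pos, sq_nonneg t])⟩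
  have key := isOpen_Ioi.ae_eq_zero_of_integral_contDiff_smul_eq_zero (μ := volume)
    (f := h) (U := Ioi 0) hi.locallyIntegrableOn fun φ hφ hc hs => by
      have h1 : ∀ t ∈ Ioi (0 : ℝ), φ t • h t
          = h t * (φ (√(-Real.log (Real.exp (-Real.pi * t ^ 2)) / Real.pi)) : ℝ) := fun t ht => by
        rw [Real.log_exp, show -(-Real.pi * t ^ 2) / Real.pi = t ^ 2 by
          field_simp, Real.sqrt_sq (le_of_lt ht), mul_comm, Complex.real_smul]
      obtain ⟨B, hB⟩ := hc.exists_bound_of_continuous hφ.continuous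
      have hint' : IntegrableOn (fun t => φ t • h t) (Ioi (0 : ℝ)) := by
        refine Integrable.bdd_smul hi B
          hφ.continuous.aestronglyMeasurable (ae_of_all _ hB)
      rw [← setIntegral_eq_integral_of_forall_compl_eq_zero (s := Ioi (0 : ℝ))]
      · rw [setIntegral_congr_fun measurableSet_Ioi h1]
        refine integral_mul_continuousOn_eq_zero hx hint hz
          (continuousOn_comp_sqrt_log hφ.continuous hc hs) ?_
        exact hint'.congr_fun h1 measurableSet_Ioi
      · intro t ht
        rw [image_eq_zero_of_notMem_tsupport fun h => ht (hs h), zero_smul]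
  rw [Lp.eq_zero_iff_ae_eq_zero]
  filter_upwards [(ae_restrict_iff' measurableSet_Ioi).2 key] with t ht
  have h2 : (Real.exp (-Real.pi * t ^ 2) : ℂ) ≠ 0 := by
    exact_mod_cast (Real.exp_pos _).ne'
  exact (mul_eq_zero.1 ht).resolve_right h2

theorem theta_add (f g : HalfLineL2) {u : ℝ} (hu : 0 < u) :
    theta (f + g) u = theta f u + theta g u := by
  rw [theta, theta, theta, ← integral_add (integrable_mul_gaussian f hu)
    (integrable_mul_gaussian g hu)]
  refine integral_congr_ae ?_
  filter_upwards [Lp.coeFn_add f g] with t ht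
  rw [ht, Pi.add_apply, add_mul]

theorem theta_smul (c : ℂ) (f : HalfLineL2) (u : ℝ) : theta (c • f) u = c * theta f u := by
  rw [theta, theta, ← integral_const_mul]
  refine integral_congr_ae ?_
  filter_upwards [Lp.coeFn_smul c f] with t ht
  rw [ht, Pi.smul_apply, smul_eq_mul, mul_assoc]

theorem theta_sub (f g : HalfLineL2) {u : ℝ} (hu : 0 < u) :
    theta (f - g) u = theta f u - theta g u := by
  rw [show f - g = f + (-1 : ℂ) • g by module, theta_add _ _ hu, theta_smul]
  ring

theorem ext_theta {f g : HalfLineL2} (h : ∀ u, 0 < u → theta f u = theta g u) : f = g := by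
  rw [← sub_eq_zero]
  exact eq_zero_of_theta_eq_zero fun u hu => by rw [theta_sub _ _ hu, h u hu, sub_self]

theorem rpow_neg_half_mul_inv {u : ℝ} (hu : 0 < u) :
    u ^ (-(1 / 2) : ℝ) * u⁻¹ ^ (-(1 / 2) : ℝ) = 1 := by
  rw [← Real.mul_rpow hu.le (inv_pos.2 hu).le, mul_inv_cancel₀ hu.ne', Real.one_rpow]

theorem cosineTransform_cosineTransform (f : HalfLineL2) :
    cosineTransform (cosineTransform f) = f := by
  refine ext_theta fun u hu => ?_
  rw [theta_cosineTransform _ hu, theta_cosineTransform _ (inv_pos.2 hu), inv_inv, ← mul_assoc,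
    ← Complex.ofReal_mul, rpow_neg_half_mul_inv hu, Complex.ofReal_one, one_mul]

theorem theta_star (f : HalfLineL2) (u : ℝ) : theta (star f) u = star (theta f u) := by
  rw [theta, theta, Complex.star_def, ← integral_conj]
  refine integral_congr_ae ?_
  filter_upwards [Lp.coeFn_star f] with t ht
  rw [ht, map_mul, Complex.conj_ofReal]; rfl

theorem cosineTransform_star (f : HalfLineL2) :
    cosineTransform (star f) = star (cosineTransform f) := by
  refine ext_theta fun u hu => ?_
  rw [theta_cosineTransform _ hu, theta_star, theta_star, theta_cosineTransform _ hu, star_mul',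
    Complex.star_def, Complex.conj_ofReal]

theorem map_mul_left_restrict_Ioi {l : ℝ} (hl : 0 < l) :
    Measure.map (fun t => l * t) (volume.restrict (Ioi (0 : ℝ)))
      = ENNReal.ofReal l⁻¹ • volume.restrict (Ioi (0 : ℝ)) := by
  have h : (fun t => l * t) ⁻¹' Ioi (0 : ℝ) = Ioi 0 := by
    ext t; simp [hl]
  have h2 := Measure.restrict_map (μ := volume) (f := fun t => l * t) (by fun_prop)
    (measurableSet_Ioi (a := (0 : ℝ)))
  rw [h, Real.map_volume_mul_left hl.ne', Measure.restrict_smul,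
    abs_of_pos (inv_pos.2 hl)] at h2
  exact h2.symm

theorem ae_comp_mul_left {p : ℝ → Prop} {l : ℝ} (hl : 0 < l)
    (h : ∀ᵐ t ∂volume.restrict (Ioi (0 : ℝ)), p t) :
    ∀ᵐ t ∂volume.restrict (Ioi (0 : ℝ)), p (l * t) := by
  refine ae_of_ae_map (f := fun t => l * t) (by fun_prop) ?_
  rw [map_mul_left_restrict_Ioi hl]
  exact Measure.ae_smul_measure h _

theorem memLp_comp_mul_left (f : HalfLineL2) {l : ℝ} (hl : 0 < l) :
    MemLp (fun t => f (l * t)) 2 (volume.restrict (Ioi (0 : ℝ))) := by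
  refine MemLp.comp_of_map (f := fun t => l * t) ?_ (by fun_prop)
  rw [map_mul_left_restrict_Ioi hl]
  exact (Lp.memLp f).smul_measure (by simp)

/-- The unitary dilation `f ↦ √l f(l t)` on `L²(0, ∞)`. -/
def dilation (l : ℝ) (hl : 0 < l) (f : HalfLineL2) : HalfLineL2 :=
  ((memLp_comp_mul_left f hl).const_mul ((√l : ℝ) : ℂ)).toLp _

theorem dilation_coeFn {l : ℝ} (hl : 0 < l) (f : HalfLineL2) :
    ⇑(dilation l hl f) =ᵐ[volume.restrict (Ioi (0 : ℝ))] fun t => (√l : ℂ) * f (l * t) :=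
  ((memLp_comp_mul_left f hl).const_mul ((√l : ℝ) : ℂ)).coeFn_toLp

theorem theta_dilation {l : ℝ} (hl : 0 < l) (f : HalfLineL2) (u : ℝ) :
    theta (dilation l hl f) u = (l ^ (-(1 / 2) : ℝ) : ℝ) * theta f (u * (l⁻¹) ^ 2) := by
  have h := integral_comp_mul_left_Ioi
    (fun t => f t * (Real.exp (-Real.pi * (u * (l⁻¹) ^ 2) * t ^ 2) : ℂ)) 0 hl
  rw [mul_zero] at h
  have h2 : theta (dilation l hl f) u = (√l : ℂ) * ∫ t in Ioi (0 : ℝ),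
      f (l * t) * (Real.exp (-Real.pi * (u * (l⁻¹) ^ 2) * (l * t) ^ 2) : ℂ) := by
    rw [theta, ← integral_const_mul]
    refine integral_congr_ae ?_
    filter_upwards [dilation_coeFn hl f] with t ht
    rw [ht, mul_assoc, mul_pow, ← mul_assoc _ (l ^ 2), mul_assoc _ (u * _), mul_assoc u, inv_pow,
      inv_mul_cancel₀ (pow_pos hl 2).ne', mul_one]
  rw [h2, h, theta, Complex.real_smul, ← mul_assoc]
  congr 1
  rw [← Complex.ofReal_mul, Real.rpow_neg hl.le, ← Real.sqrt_eq_rpow]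
  congr 1
  have := Real.sqrt_pos.2 hl
  field_simp
  exact Real.sq_sqrt hl.le

theorem cosineTransform_dilation {l : ℝ} (hl : 0 < l) (f : HalfLineL2) :
    cosineTransform (dilation l hl f) = dilation l⁻¹ (inv_pos.2 hl) (cosineTransform f) := by
  refine ext_theta fun u hu => ?_
  rw [theta_cosineTransform _ hu, theta_dilation, theta_dilation,
    theta_cosineTransform _ (by positivity), inv_inv, ← mul_assoc, ← mul_assoc,
    ← Complex.ofReal_mul, ← Complex.ofReal_mul]
  refine congrArg₂ _ (congrArg _ ?_) (congrArg _ ?_)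
  · rw [Real.inv_rpow hl.le, Real.mul_rpow hu.le (by positivity), ← Real.rpow_natCast,
      ← Real.rpow_mul hl.le, ← Real.rpow_neg hl.le, mul_left_comm, ← Real.rpow_add hl]
    norm_num
  · rw [mul_inv, inv_pow]

theorem dilation_mem_vanishingBelow {a b l : ℝ} (hl : 0 < l) (hab : l * a ≤ b) {f : HalfLineL2}
    (hf : f ∈ vanishingBelow b) : dilation l hl f ∈ vanishingBelow a := by
  have hf' : ∀ᵐ t ∂volume.restrict (Ioi (0 : ℝ)), t < b → f t = 0 := hf
  change ∀ᵐ t ∂volume.restrict (Ioi (0 : ℝ)), t < a → _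
  filter_upwards [dilation_coeFn hl f, ae_comp_mul_left hl hf'] with t h1 h2 hta
  rw [h1, h2 ((mul_lt_mul_of_pos_left hta hl).trans_le hab), mul_zero]

theorem vanishingBelow_anti {a b : ℝ} (hab : a ≤ b) : vanishingBelow b ≤ vanishingBelow a := by
  intro f hf
  have hf' : ∀ᵐ t ∂volume.restrict (Ioi (0 : ℝ)), t < b → f t = 0 := hf
  change ∀ᵐ t ∂volume.restrict (Ioi (0 : ℝ)), t < a → _
  filter_upwards [hf'] with t h hta
  exact h (hta.trans_le hab)

theorem mem_sonineSpace {a : ℝ} {f : HalfLineL2} :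
    f ∈ sonineSpace a ↔ f ∈ vanishingBelow a ∧ cosineTransform f ∈ vanishingBelow a :=
  Iff.rfl

theorem sonineSpace_anti {a b : ℝ} (hab : a ≤ b) : sonineSpace b ≤ sonineSpace a := fun _ hf =>
  ⟨vanishingBelow_anti hab hf.1, vanishingBelow_anti hab hf.2⟩

theorem dilation_mem_sonineSpace {a b l : ℝ} (hl : 0 < l) (h1 : l * a ≤ b) (h2 : a ≤ l * b)
    {f : HalfLineL2} (hf : f ∈ sonineSpace b) : dilation l hl f ∈ sonineSpace a := by
  rw [mem_sonineSpace] at hf ⊢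
  refine ⟨dilation_mem_vanishingBelow hl h1 hf.1, ?_⟩
  rw [cosineTransform_dilation hl]
  refine dilation_mem_vanishingBelow _ ?_ hf.2
  rwa [inv_mul_le_iff₀ hl]

theorem cosineTransform_mem_sonineSpace {a : ℝ} {f : HalfLineL2} (hf : f ∈ sonineSpace a) :
    cosineTransform f ∈ sonineSpace a := by
  rw [mem_sonineSpace] at hf ⊢
  rw [cosineTransform_cosineTransform]
  exact hf.symm

theorem star_mem_vanishingBelow {a : ℝ} {f : HalfLineL2} (hf : f ∈ vanishingBelow a) :
    star f ∈ vanishingBelow a := by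
  have hf' : ∀ᵐ t ∂volume.restrict (Ioi (0 : ℝ)), t < a → f t = 0 := hf
  change ∀ᵐ t ∂volume.restrict (Ioi (0 : ℝ)), t < a → _
  filter_upwards [Lp.coeFn_star f, hf'] with t h1 h2 hta
  rw [h1, Pi.star_apply, h2 hta, star_zero]

theorem star_mem_sonineSpace {a : ℝ} {f : HalfLineL2} (hf : f ∈ sonineSpace a) :
    star f ∈ sonineSpace a := by
  rw [mem_sonineSpace] at hf ⊢
  refine ⟨star_mem_vanishingBelow hf.1, ?_⟩
  rw [cosineTransform_star]
  exact star_mem_vanishingBelow hf.2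

/-- The bounded linear functional `f ↦ ∫_0^∞ f g` on `L²(0, ∞)`. -/
def pairingCLM (g : HalfLineL2) : HalfLineL2 →L[ℂ] ℂ :=
  (ContinuousLinearMap.mul ℂ ℂ).lpPairing (volume.restrict (Ioi (0 : ℝ))) 2 2 g

theorem pairingCLM_apply (g f : HalfLineL2) :
    pairingCLM g f = ∫ t in Ioi (0 : ℝ), g t * f t :=
  lpPairing_mul_apply g f

theorem inner_eq_integral_star_mul (f g : HalfLineL2) :
    inner ℂ f g = ∫ t in Ioi (0 : ℝ), (star f : HalfLineL2) t * g t := by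
  rw [L2.inner_def]
  refine integral_congr_ae ?_
  filter_upwards [Lp.coeFn_star f] with t ht
  rw [ht, RCLike.inner_apply, mul_comm]; rfl

/-- The indicator of `(0, a)` times `f`, as a projection in `L²(0, ∞)`. -/
theorem exists_cutoff (a : ℝ) (f : HalfLineL2) : ∃ g : HalfLineL2,
    g =ᵐ[volume.restrict (Ioi (0 : ℝ))] (Iio a).indicator f :=
  ⟨((Lp.memLp f).indicator measurableSet_Iio).toLp _, MemLp.coeFn_toLp _⟩

theorem mem_vanishingBelow_iff_forall {a : ℝ} {f : HalfLineL2} :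
    f ∈ vanishingBelow a ↔ ∀ g : HalfLineL2,
      (∀ᵐ t ∂volume.restrict (Ioi (0 : ℝ)), a ≤ t → g t = 0) → pairingCLM g f = 0 := by
  constructor
  · intro hf g hg
    have hf' : ∀ᵐ t ∂volume.restrict (Ioi (0 : ℝ)), t < a → f t = 0 := hf
    rw [pairingCLM_apply]
    refine integral_eq_zero_of_ae ?_
    filter_upwards [hf', hg] with t h1 h2
    rcases lt_or_ge t a with h | h
    · simp [h1 h]
    · simp [h2 h]
  · intro h
    obtain ⟨g, hg⟩ := exists_cutoff a (star f)
    have h0 := h g (by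
      filter_upwards [hg] with t ht hat
      rw [ht, indicator_of_notMem (by simpa using hat)])
    have hn : g = 0 := by
      have h3 : inner ℂ g g = (0 : ℂ) := by
        rw [inner_eq_integral_star_mul, ← h0, pairingCLM_apply]
        refine integral_congr_ae ?_
        filter_upwards [hg, Lp.coeFn_star g, Lp.coeFn_star f] with t h1 h2 h4
        rw [h2, Pi.star_apply, h1]
        by_cases hta : t ∈ Iio a
        · rw [indicator_of_mem hta, h4, Pi.star_apply, star_star, mul_comm]
        · rw [indicator_of_notMem hta, star_zero, zero_mul, zero_mul]
      exact inner_self_eq_zero.1 h3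
    change ∀ᵐ t ∂volume.restrict (Ioi (0 : ℝ)), t < a → f t = 0
    rw [hn] at hg
    filter_upwards [hg, Lp.coeFn_zero ℂ 2 (volume.restrict (Ioi (0 : ℝ))),
      Lp.coeFn_star f] with t h1 h2 h4 hta
    rw [h2, indicator_of_mem (mem_Iio.2 hta), h4, Pi.star_apply] at h1
    exact star_eq_zero.1 h1.symm

theorem isClosed_vanishingBelow (a : ℝ) : IsClosed (vanishingBelow a : Set HalfLineL2) := by
  have : (vanishingBelow a : Set HalfLineL2) = ⋂ (g : HalfLineL2)
      (_ : ∀ᵐ t ∂volume.restrict (Ioi (0 : ℝ)), a ≤ t → g t = 0), {f | pairingCLM g f = 0} := by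
    ext f
    simp only [SetLike.mem_coe, mem_vanishingBelow_iff_forall, mem_iInter, mem_ofPred_eq]
  rw [this]
  exact isClosed_iInter fun g => isClosed_iInter fun _ =>
    isClosed_eq (pairingCLM g).continuous continuous_const

theorem continuous_cosineTransform : Continuous cosineTransform := by
  obtain ⟨C, -, hC⟩ := exists_norm_cosineTransform_le
  exact (cosineTransform.mkContinuous C hC).continuous

theorem isClosed_sonineSpace (a : ℝ) : IsClosed (sonineSpace a : Set HalfLineL2) :=
  (isClosed_vanishingBelow a).inter
    ((isClosed_vanishingBelow a).preimage continuous_cosineTransform)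

theorem integral_norm_mul_norm_le {α : Type*} [MeasurableSpace α] {μ : Measure α}
    (f g : Lp ℂ 2 μ) : ∫ x, ‖f x‖ * ‖g x‖ ∂μ ≤ ‖f‖ * ‖g‖ := by
  have hf := (Lp.memLp f).norm
  have hg := (Lp.memLp g).norm
  have h := real_inner_le_norm (hf.toLp _) (hg.toLp _)
  rw [L2.inner_def, Lp.norm_toLp, Lp.norm_toLp, eLpNorm_norm, eLpNorm_norm, ← Lp.norm_def,
    ← Lp.norm_def] at h
  refine le_trans (le_of_eq ?_) h
  refine integral_congr_ae ?_
  filter_upwards [hf.coeFn_toLp, hg.coeFn_toLp] with x h1 h2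
  rw [h1, h2, real_inner_eq_re_inner, RCLike.inner_apply]
  simp [mul_comm]

theorem norm_theta_le {a : ℝ} (ha : 0 ≤ a) {f : HalfLineL2} (hf : f ∈ vanishingBelow a) {u : ℝ}
    (hu : 1 ≤ u) :
    ‖theta f u‖ ≤ ‖gaussian (1 / 2) (by norm_num)‖ * ‖f‖ * Real.exp (-(Real.pi * a ^ 2 / 2 * u)) := by
  have hf' : ∀ᵐ t ∂volume.restrict (Ioi (0 : ℝ)), t < a → f t = 0 := hf
  set g := gaussian (1 / 2) (by norm_num)
  have h1 : ‖theta f u‖ ≤ ∫ t in Ioi (0 : ℝ),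
      Real.exp (-(Real.pi * a ^ 2 / 2 * u)) * (‖f t‖ * ‖g t‖) := by
    refine norm_integral_le_of_norm_le
      (((Lp.memLp f).norm.integrable_mul (Lp.memLp g).norm).const_mul _) ?_
    filter_upwards [hf', gaussian_coeFn (show (0 : ℝ) < 1 / 2 by norm_num)] with t h1 h2
    rcases lt_or_ge t a with hta | hta
    · rw [h1 hta]; simp
    · rw [h2, norm_mul, Complex.norm_real, Complex.norm_real, Real.norm_of_nonneg (Real.exp_nonneg _),
        Real.norm_of_nonneg (Real.exp_nonneg _), mul_left_comm, ← Real.exp_add]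
      gcongr
      have h3 : a ^ 2 ≤ t ^ 2 := by gcongr
      have h4 : a ^ 2 * (u - 1 / 2) ≤ t ^ 2 * (u - 1 / 2) :=
        mul_le_mul_of_nonneg_right h3 (by linarith)
      have h5 : 0 ≤ a ^ 2 * (u - 1) := mul_nonneg (sq_nonneg a) (by linarith)
      have h6 : a ^ 2 / 2 * u + 1 / 2 * t ^ 2 ≤ u * t ^ 2 := by nlinarith
      nlinarith [mul_le_mul_of_nonneg_left h6 Real.pi_pos.le]
  rw [integral_const_mul] at h1
  refine h1.trans ?_
  rw [mul_comm, mul_comm ‖g‖]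
  exact mul_le_mul_of_nonneg_right (integral_norm_mul_norm_le f g) (Real.exp_nonneg _)

theorem exp_neg_mul_le {c : ℝ} (hc : 0 < c) (N : ℕ) {u : ℝ} (hu : 0 < u) :
    Real.exp (-(c * u)) ≤ N.factorial / c ^ N * (u ^ N)⁻¹ := by
  have h := Real.pow_div_factorial_le_exp (c * u) (by positivity) N
  rw [Real.exp_neg]
  calc (Real.exp (c * u))⁻¹ ≤ ((c * u) ^ N / N.factorial)⁻¹ := inv_anti₀ (by positivity) h
    _ = _ := by rw [mul_pow]; field_simp

theorem exists_norm_theta_le {a : ℝ} (ha : 0 < a) (N : ℕ) :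
    ∃ C : ℝ, 0 ≤ C ∧ ∀ f ∈ sonineSpace a, ∀ u : ℝ, 0 < u →
      ‖theta f u‖ ≤ C * ‖f‖ * u ^ N ∧ ‖theta f u‖ ≤ C * ‖f‖ * (u ^ N)⁻¹ := by
  obtain ⟨D, hD0, hD⟩ := exists_norm_cosineTransform_le
  set G := ‖gaussian (1 / 2) (by norm_num)‖
  set c := Real.pi * a ^ 2 / 2
  have hc : 0 < c := by have := Real.pi_pos; positivity
  set A := G * ((N + 1).factorial / c ^ (N + 1))
  have hA : 0 ≤ A := by positivity
  have h1 : ∀ f ∈ vanishingBelow a, ∀ u : ℝ, 1 ≤ u → ‖theta f u‖ ≤ A * ‖f‖ * (u ^ (N + 1))⁻¹ :=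
    fun f hf u hu => by
      refine (norm_theta_le ha.le hf hu).trans ?_
      calc _ ≤ G * ‖f‖ * ((N + 1).factorial / c ^ (N + 1) * (u ^ (N + 1))⁻¹) := by
            gcongr
            exact exp_neg_mul_le hc (N + 1) (by linarith)
        _ = _ := by ring
  refine ⟨A * (1 + D), by positivity, fun f hf u hu => ?_⟩
  rw [mem_sonineSpace] at hf
  have hAf : 0 ≤ A * ‖f‖ := by positivity
  rcases le_total 1 u with h | h
  · have h2 : ‖theta f u‖ ≤ A * (1 + D) * ‖f‖ * (u ^ N)⁻¹ := by
      refine (h1 f hf.1 u h).trans ?_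
      have : (u ^ (N + 1))⁻¹ ≤ (u ^ N)⁻¹ :=
        inv_anti₀ (by positivity) (pow_le_pow_right₀ h (Nat.le_succ N))
      gcongr
      nlinarith
    refine ⟨h2.trans ?_, h2⟩
    gcongr
    exact (inv_le_one_of_one_le₀ (one_le_pow₀ h)).trans (one_le_pow₀ h)
  · have h2 : ‖theta f u‖ ≤ A * (1 + D) * ‖f‖ * u ^ N := by
      rw [← cosineTransform_cosineTransform f, theta_cosineTransform _ hu, norm_mul,
        Complex.norm_real, Real.norm_of_nonneg (by positivity), cosineTransform_cosineTransform]
      have h3 := h1 _ hf.2 u⁻¹ (one_le_inv₀ hu |>.2 h)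
      have h4 : u ^ (-(1 / 2) : ℝ) ≤ u⁻¹ := by
        rw [← Real.rpow_neg_one]
        exact Real.rpow_le_rpow_of_exponent_ge hu h (by norm_num)
      calc _ ≤ u⁻¹ * (A * (D * ‖f‖) * (u⁻¹ ^ (N + 1))⁻¹) := by
            gcongr
            refine h3.trans ?_
            gcongr
            exact hD f
        _ = A * D * ‖f‖ * u ^ N := by
            rw [inv_pow, inv_inv, pow_succ]; field_simp
        _ ≤ _ := by gcongr; linarith
    refine ⟨h2, h2.trans ?_⟩
    gcongr
    exact (pow_le_one₀ hu.le h).trans (one_le_inv₀ (by positivity) |>.2 (pow_le_one₀ hu.le h))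

theorem continuousOn_theta (f : HalfLineL2) : ContinuousOn (theta f) (Ioi 0) := by
  intro u hu
  rw [mem_Ioi] at hu
  refine ContinuousAt.continuousWithinAt ?_
  refine continuousAt_of_dominated
    (bound := fun t => ‖f t * (Real.exp (-Real.pi * (u / 2) * t ^ 2) : ℂ)‖) ?_ ?_
    (integrable_mul_gaussian f (half_pos hu)).norm ?_
  · refine Eventually.of_forall fun v => (Lp.aestronglyMeasurable f).mul ?_
    exact (by fun_prop : Continuous fun t : ℝ =>
      (Real.exp (-Real.pi * v * t ^ 2) : ℂ)).aestronglyMeasurable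
  · filter_upwards [lt_mem_nhds (half_lt_self hu)] with v hv
    refine ae_of_all _ fun t => ?_
    rw [norm_mul, norm_mul, Complex.norm_real, Complex.norm_real,
      Real.norm_of_nonneg (Real.exp_nonneg _), Real.norm_of_nonneg (Real.exp_nonneg _)]
    gcongr 2
    have : u / 2 * t ^ 2 ≤ v * t ^ 2 := by gcongr
    nlinarith [mul_le_mul_of_nonneg_left this Real.pi_pos.le]
  · refine ae_of_all _ fun t => ?_
    fun_prop

theorem theta_isBigO {a : ℝ} (ha : 0 < a) {f : HalfLineL2} (hf : f ∈ sonineSpace a) (N : ℕ) :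
    theta f =O[atTop] (fun u : ℝ => u ^ (-(N : ℝ))) ∧
      theta f =O[𝓝[>] 0] (fun u : ℝ => u ^ (-(-(N : ℝ)))) := by
  obtain ⟨C, -, hC⟩ := exists_norm_theta_le ha N
  constructor
  · refine Asymptotics.IsBigO.of_bound (C * ‖f‖) ?_
    filter_upwards [eventually_gt_atTop 0] with u hu
    refine (hC f hf u hu).2.trans (le_of_eq ?_)
    rw [Real.norm_of_nonneg (by positivity), Real.rpow_neg hu.le, Real.rpow_natCast]
  · refine Asymptotics.IsBigO.of_bound (C * ‖f‖) ?_
    filter_upwards [self_mem_nhdsWithin] with u hu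
    rw [mem_Ioi] at hu
    refine (hC f hf u hu).1.trans (le_of_eq ?_)
    rw [Real.norm_of_nonneg (by positivity), neg_neg, Real.rpow_natCast]

theorem mellinConvergent_theta {a : ℝ} (ha : 0 < a) {f : HalfLineL2} (hf : f ∈ sonineSpace a)
    (s : ℂ) : MellinConvergent (theta f) s := by
  obtain ⟨N, hN⟩ := exists_nat_gt |s.re|
  rw [abs_lt] at hN
  obtain ⟨h1, h2⟩ := theta_isBigO ha hf N
  exact mellinConvergent_of_isBigO_rpow
    ((continuousOn_theta f).locallyIntegrableOn measurableSet_Ioi) h1 hN.2 h2 hN.1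

theorem differentiable_mellin_theta {a : ℝ} (ha : 0 < a) {f : HalfLineL2}
    (hf : f ∈ sonineSpace a) : Differentiable ℂ (mellin (theta f)) := by
  intro s
  obtain ⟨N, hN⟩ := exists_nat_gt |s.re|
  rw [abs_lt] at hN
  obtain ⟨h1, h2⟩ := theta_isBigO ha hf N
  exact mellin_differentiableAt_of_isBigO_rpow
    ((continuousOn_theta f).locallyIntegrableOn measurableSet_Ioi) h1 hN.2 h2 hN.1

theorem exists_norm_mellin_theta_le {a : ℝ} (ha : 0 < a) (R : ℝ) :
    ∃ C : ℝ, 0 ≤ C ∧ ∀ f ∈ sonineSpace a, ∀ s : ℂ, |s.re| ≤ R →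
      ‖mellin (theta f) s‖ ≤ C * ‖f‖ := by
  obtain ⟨N, hN⟩ := exists_nat_ge (R + 1)
  obtain ⟨C, hC0, hC⟩ := exists_norm_theta_le ha N
  set g : ℝ → ℝ := (Ioc (0 : ℝ) 1).indicator (fun _ => 1) + (Ioi (1 : ℝ)).indicator
    (fun u => u ^ (-2 : ℝ))
  have hg : Integrable g := by
    refine Integrable.add ?_ ?_
    · rw [integrable_indicator_iff measurableSet_Ioc]
      exact integrableOn_const (by simp)
    · rw [integrable_indicator_iff measurableSet_Ioi]
      exact integrableOn_Ioi_rpow_of_lt (by norm_num) one_pos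
  refine ⟨C * |∫ u in Ioi (0 : ℝ), g u|, by positivity, fun f hf s hs => ?_⟩
  have h1 : ‖mellin (theta f) s‖ ≤ ∫ u in Ioi (0 : ℝ), C * ‖f‖ * g u := by
    refine norm_integral_le_of_norm_le (hg.integrableOn.const_mul _) ?_
    filter_upwards [ae_restrict_mem measurableSet_Ioi] with u hu
    rw [mem_Ioi] at hu
    obtain ⟨h2, h3⟩ := hC f hf u hu
    rw [norm_smul, Complex.norm_cpow_eq_rpow_re_of_pos hu, Complex.sub_re, Complex.one_re]
    rw [abs_le] at hs
    rcases le_or_gt u 1 with h | h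
    · have hgu : g u = 1 := by
        simp [g, hu, h]
      rw [hgu]
      calc _ ≤ u ^ (s.re - 1) * (C * ‖f‖ * u ^ N) := by gcongr
        _ = C * ‖f‖ * u ^ (s.re - 1 + N) := by
            rw [Real.rpow_add hu, Real.rpow_natCast]; ring
        _ ≤ _ := by
            gcongr
            exact Real.rpow_le_one hu.le h (by linarith)
    · have hgu : g u = u ^ (-2 : ℝ) := by
        simp [g, h]
      rw [hgu]
      calc _ ≤ u ^ (s.re - 1) * (C * ‖f‖ * (u ^ N)⁻¹) := by gcongr
        _ = C * ‖f‖ * u ^ (s.re - 1 - N) := by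
            rw [Real.rpow_sub hu _ (N : ℝ), Real.rpow_natCast]; ring
        _ ≤ _ := by
            gcongr
            · exact h.le
            · linarith
  rw [integral_const_mul] at h1
  refine h1.trans ?_
  calc _ ≤ C * ‖f‖ * |∫ u in Ioi (0 : ℝ), g u| := by gcongr; exact le_abs_self _
    _ = _ := by ring

theorem memLp_indicator_cpow {a : ℝ} (ha : 0 < a) {s : ℂ} (hs : 1 / 2 < s.re) :
    MemLp ((Ici a).indicator fun t : ℝ => (t : ℂ) ^ (-s)) 2 (volume.restrict (Ioi (0 : ℝ))) := by
  have hm : AEStronglyMeasurable (fun t : ℝ => (t : ℂ) ^ (-s)) (volume.restrict (Ici a)) :=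
    (by fun_prop : Measurable fun t : ℝ => (t : ℂ) ^ (-s)).aestronglyMeasurable
  refine MemLp.restrict _ ?_
  rw [memLp_indicator_iff_restrict measurableSet_Ici, memLp_two_iff_integrable_sq_norm hm]
  change IntegrableOn _ _ _
  rw [integrableOn_Ici_iff_integrableOn_Ioi]
  refine (integrableOn_Ioi_rpow_of_lt (a := -(2 * s.re)) (by linarith) ha).congr_fun
    (fun t ht => ?_) measurableSet_Ioi
  have ht0 : 0 < t := ha.trans ht
  simp only
  rw [Complex.norm_cpow_eq_rpow_re_of_pos ht0, ← Real.rpow_natCast, ← Real.rpow_mul ht0.le,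
    Complex.neg_re]
  congr 1
  push_cast
  ring

theorem integrable_mul_cpow {a : ℝ} (ha : 0 < a) {f : HalfLineL2} (hf : f ∈ vanishingBelow a)
    {s : ℂ} (hs : 1 / 2 < s.re) :
    IntegrableOn (fun t => f t * (t : ℂ) ^ (-s)) (Ioi (0 : ℝ)) := by
  have hf' : ∀ᵐ t ∂volume.restrict (Ioi (0 : ℝ)), t < a → f t = 0 := hf
  refine ((Lp.memLp f).integrable_mul (memLp_indicator_cpow ha hs)).congr ?_
  filter_upwards [hf'] with t ht
  rw [Pi.mul_apply]
  by_cases hta : t ∈ Ici a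
  · rw [indicator_of_mem hta]
  · rw [ht (by simpa using hta), zero_mul, zero_mul]

theorem ofReal_cpow_eq_exp {x : ℝ} (hx : 0 < x) (z : ℂ) :
    (x : ℂ) ^ z = Complex.exp (Real.log x * z) := by
  rw [Complex.cpow_def_of_ne_zero (by exact_mod_cast hx.ne'), Complex.ofReal_log hx.le]

theorem norm_cpow_mul_exp {t u : ℝ} (hu : 0 < u) (s : ℂ) :
    ‖(u : ℂ) ^ (s / 2 - 1) * (Real.exp (-Real.pi * u * t ^ 2) : ℂ)‖
      = u ^ (s.re / 2 - 1) * Real.exp (-(Real.pi * t ^ 2 * u)) := by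
  rw [norm_mul, Complex.norm_real, Real.norm_of_nonneg (Real.exp_nonneg _),
    Complex.norm_cpow_eq_rpow_re_of_pos hu]
  congr 2
  · simp
  · ring

theorem integral_cpow_mul_gaussian {t : ℝ} (ht : 0 < t) {s : ℂ} (hs : 0 < s.re) :
    ∫ u in Ioi (0 : ℝ), (u : ℂ) ^ (s / 2 - 1) * (Real.exp (-Real.pi * u * t ^ 2) : ℂ)
      = (Real.pi : ℂ) ^ (-s / 2) * Complex.Gamma (s / 2) * (t : ℂ) ^ (-s) := by
  have hr : 0 < Real.pi * t ^ 2 := by have := Real.pi_pos; positivity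
  have h := Complex.integral_cpow_mul_exp_neg_mul_Ioi (a := s / 2) (r := Real.pi * t ^ 2)
    (by simpa using hs) hr
  have hc : ((1 : ℂ) / ((Real.pi * t ^ 2 : ℝ) : ℂ)) ^ (s / 2)
      = (Real.pi : ℂ) ^ (-s / 2) * (t : ℂ) ^ (-s) := by
    rw [← Complex.ofReal_one, ← Complex.ofReal_div, ofReal_cpow_eq_exp (by positivity),
      ofReal_cpow_eq_exp Real.pi_pos, ofReal_cpow_eq_exp ht, ← Complex.exp_add, one_div,
      Real.log_inv, Real.log_mul Real.pi_pos.ne' (by positivity), Real.log_pow]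
    congr 1
    push_cast
    ring
  rw [mul_right_comm, ← hc, ← h]
  refine setIntegral_congr_fun measurableSet_Ioi fun u _ => ?_
  congr 1
  push_cast
  congr 1
  ring

theorem integral_rpow_mul_gaussian {t : ℝ} (ht : 0 < t) {σ : ℝ} (hs : 0 < σ) :
    ∫ u in Ioi (0 : ℝ), u ^ (σ / 2 - 1) * Real.exp (-(Real.pi * t ^ 2 * u))
      = (1 / Real.pi) ^ (σ / 2) * Real.Gamma (σ / 2) * t ^ (-σ) := by
  have hr : 0 < Real.pi * t ^ 2 := by have := Real.pi_pos; positivity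
  rw [Real.integral_rpow_mul_exp_neg_mul_Ioi (a := σ / 2) (r := Real.pi * t ^ 2)
    (by positivity) hr, one_div, one_div, mul_inv, Real.mul_rpow (by positivity) (by positivity)]
  have : (t ^ 2)⁻¹ ^ (σ / 2) = t ^ (-σ) := by
    rw [← Real.rpow_natCast, ← Real.rpow_neg ht.le, ← Real.rpow_mul ht.le]
    congr 1
    push_cast
    ring
  rw [this]
  ring

theorem integrableOn_cpow_mul_gaussian {t : ℝ} (ht : 0 < t) {s : ℂ} (hs : 0 < s.re) :
    IntegrableOn (fun u : ℝ => (u : ℂ) ^ (s / 2 - 1) * (Real.exp (-Real.pi * u * t ^ 2) : ℂ))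
      (Ioi (0 : ℝ)) := by
  have hr : 0 < Real.pi * t ^ 2 := by have := Real.pi_pos; positivity
  have h : IntegrableOn (fun u : ℝ => u ^ (s.re / 2 - 1) * Real.exp (-(Real.pi * t ^ 2 * u)))
      (Ioi (0 : ℝ)) := by
    refine .of_integral_ne_zero ?_
    rw [Real.integral_rpow_mul_exp_neg_mul_Ioi (a := s.re / 2) (r := Real.pi * t ^ 2)
      (by positivity) hr]
    have := Real.Gamma_pos_of_pos (show 0 < s.re / 2 by positivity)
    positivity
  refine h.mono' (by fun_prop) ?_
  filter_upwards [ae_restrict_mem measurableSet_Ioi] with u hu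
  rw [norm_cpow_mul_exp hu]

/-- For `Re s > 1/2` the Mellin transform of `theta f` is the completed right Mellin transform. -/
theorem mellin_theta_eq {a : ℝ} (ha : 0 < a) {f : HalfLineL2} (hf : f ∈ vanishingBelow a)
    {s : ℂ} (hs : 1 / 2 < s.re) :
    mellin (theta f) (s / 2)
      = (Real.pi : ℂ) ^ (-s / 2) * Complex.Gamma (s / 2) * rightMellin f s := by
  have hs0 : 0 < s.re := by linarith
  let K : ℝ → ℝ → ℂ := fun t u =>
    f t * ((u : ℂ) ^ (s / 2 - 1) * (Real.exp (-Real.pi * u * t ^ 2) : ℂ))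
  have hm : AEStronglyMeasurable (Function.uncurry K)
      ((volume.restrict (Ioi (0 : ℝ))).prod (volume.restrict (Ioi (0 : ℝ)))) := by
    refine AEStronglyMeasurable.mul (Lp.aestronglyMeasurable f).comp_fst ?_
    exact (by fun_prop : Measurable fun p : ℝ × ℝ =>
      ((p.2 : ℂ) ^ (s / 2 - 1) * (Real.exp (-Real.pi * p.2 * p.1 ^ 2) : ℂ))).aestronglyMeasurable
  have hK : Integrable (Function.uncurry K)
      ((volume.restrict (Ioi (0 : ℝ))).prod (volume.restrict (Ioi (0 : ℝ)))) := by
    rw [integrable_prod_iff hm]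
    constructor
    · filter_upwards [ae_restrict_mem measurableSet_Ioi] with t ht
      exact (integrableOn_cpow_mul_gaussian ht hs0).const_mul (f t)
    · refine ((integrable_mul_cpow ha hf hs).norm.const_mul
        ((1 / Real.pi) ^ (s.re / 2) * Real.Gamma (s.re / 2))).congr ?_
      filter_upwards [ae_restrict_mem measurableSet_Ioi] with t ht
      have h1 : ∀ u ∈ Ioi (0 : ℝ), ‖Function.uncurry K (t, u)‖
          = ‖f t‖ * (u ^ (s.re / 2 - 1) * Real.exp (-(Real.pi * t ^ 2 * u))) := fun u hu => by
        simp only [Function.uncurry, K]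
        rw [norm_mul, norm_cpow_mul_exp hu]
      rw [setIntegral_congr_fun measurableSet_Ioi h1, integral_const_mul,
        integral_rpow_mul_gaussian ht hs0, norm_mul, Complex.norm_cpow_eq_rpow_re_of_pos ht,
        Complex.neg_re]
      ring
  have hsw := integral_integral_swap hK
  rw [mellin, rightMellin, ← integral_const_mul]
  refine Eq.trans ?_ (hsw.symm.trans ?_)
  · refine integral_congr_ae (ae_of_all _ fun u => ?_)
    simp only [K, theta, smul_eq_mul]
    rw [← integral_const_mul]
    refine integral_congr_ae (ae_of_all _ fun t => ?_)
    simp only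
    ring
  · refine setIntegral_congr_fun measurableSet_Ioi fun t ht => ?_
    simp only [K]
    rw [integral_const_mul, integral_cpow_mul_gaussian ht hs0]
    ring

/-- The Mellin transform `∫_0^∞ u^{s/2 - 1} θ_f(u) du` of the theta function of `f`. -/
def thetaMellin (f : HalfLineL2) (s : ℂ) : ℂ := mellin (theta f) (s / 2)

theorem differentiable_thetaMellin {a : ℝ} (ha : 0 < a) {f : HalfLineL2}
    (hf : f ∈ sonineSpace a) : Differentiable ℂ (thetaMellin f) :=
  (differentiable_mellin_theta ha hf).comp (by fun_prop : Differentiable ℂ fun s : ℂ => s / 2)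

theorem eq_of_eqOn_halfPlane {F G : ℂ → ℂ} (hF : Differentiable ℂ F) (hG : Differentiable ℂ G)
    (c : ℝ) (h : ∀ s : ℂ, c < s.re → F s = G s) : F = G := by
  refine AnalyticOnNhd.eq_of_eventuallyEq (z₀ := ((c + 1 : ℝ) : ℂ))
    (fun z _ => hF.analyticAt z) (fun z _ => hG.analyticAt z) ?_
  have : {s : ℂ | c < s.re} ∈ 𝓝 ((c + 1 : ℝ) : ℂ) :=
    (isOpen_lt continuous_const Complex.continuous_re).mem_nhds (by simp)
  filter_upwards [this] with s hs using h s hs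

theorem completedMellin_eq {a : ℝ} (ha : 0 < a) {f : HalfLineL2} (hf : f ∈ sonineSpace a) :
    completedMellin f = thetaMellin f := by
  have h : IsCompletedMellin f (thetaMellin f) :=
    ⟨differentiable_thetaMellin ha hf, fun s hs => mellin_theta_eq ha (mem_sonineSpace.1 hf).1 hs⟩
  have hex : ∃ F, IsCompletedMellin f F := ⟨_, h⟩
  rw [completedMellin, dif_pos hex]
  exact eq_of_eqOn_halfPlane hex.choose_spec.1 h.1 (1 / 2) fun s hs => by
    rw [hex.choose_spec.2 s hs, h.2 s hs]

theorem thetaMellin_cosineTransform (f : HalfLineL2) (s : ℂ) :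
    thetaMellin (cosineTransform f) s = thetaMellin f (1 - s) := by
  have h : mellin (theta (cosineTransform f)) (s / 2)
      = mellin (fun u : ℝ => (u : ℂ) ^ (-(1 / 2) : ℂ) • theta f u⁻¹) (s / 2) := by
    refine setIntegral_congr_fun measurableSet_Ioi fun u hu => ?_
    simp only
    rw [theta_cosineTransform f hu, Complex.ofReal_cpow (le_of_lt hu), smul_eq_mul (a := (u : ℂ) ^ _)
      (b := theta f _)]
    push_cast
    rfl
  rw [thetaMellin, h, mellin_cpow_smul, mellin_comp_inv, thetaMellin]
  congr 1
  ring

theorem thetaMellin_dilation {l : ℝ} (hl : 0 < l) (f : HalfLineL2) (s : ℂ) :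
    thetaMellin (dilation l hl f) s = (l : ℂ) ^ (s - 1 / 2) * thetaMellin f s := by
  have h : mellin (theta (dilation l hl f)) (s / 2)
      = mellin (fun u : ℝ => ((l ^ (-(1 / 2) : ℝ) : ℝ) : ℂ) • theta f (u * (l⁻¹) ^ 2)) (s / 2) := by
    refine setIntegral_congr_fun measurableSet_Ioi fun u hu => ?_
    simp only
    rw [theta_dilation hl, smul_eq_mul (a := ((l ^ (-(1 / 2) : ℝ) : ℝ) : ℂ))]
  rw [thetaMellin, h, mellin_const_smul, mellin_comp_mul_right _ _ (by positivity), smul_eq_mul,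
    smul_eq_mul, ← mul_assoc, thetaMellin]
  congr 1
  rw [Complex.ofReal_cpow hl.le, ofReal_cpow_eq_exp hl, ofReal_cpow_eq_exp hl,
    ofReal_cpow_eq_exp (by positivity), ← Complex.exp_add, Real.log_pow, Real.log_inv]
  congr 1
  push_cast
  ring

theorem thetaMellin_smul (c : ℂ) (f : HalfLineL2) (s : ℂ) :
    thetaMellin (c • f) s = c * thetaMellin f s := by
  rw [thetaMellin, thetaMellin, ← smul_eq_mul, ← mellin_const_smul]
  congr 1
  funext u
  rw [theta_smul, smul_eq_mul]

theorem thetaMellin_add {a : ℝ} (ha : 0 < a) {f g : HalfLineL2} (hf : f ∈ sonineSpace a)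
    (hg : g ∈ sonineSpace a) (s : ℂ) :
    thetaMellin (f + g) s = thetaMellin f s + thetaMellin g s := by
  rw [thetaMellin, thetaMellin, thetaMellin, ← (hasMellin_add (mellinConvergent_theta ha hf (s / 2))
    (mellinConvergent_theta ha hg (s / 2))).2]
  refine setIntegral_congr_fun measurableSet_Ioi fun u hu => ?_
  simp only
  rw [theta_add f g hu]

/-- Mellin injectivity on Sonine spaces. -/
theorem eq_zero_of_thetaMellin_eq_zero {a : ℝ} (ha : 0 < a) {f : HalfLineL2}
    (hf : f ∈ sonineSpace a) (h : ∀ s, thetaMellin f s = 0) : f = 0 := by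
  refine eq_zero_of_theta_eq_zero fun u hu => ?_
  have h0 : mellin (theta f) = 0 := by
    funext s
    have := h (2 * s)
    rwa [thetaMellin, mul_div_cancel_left₀ _ two_ne_zero] at this
  rw [← mellinInv_mellin_eq 0 (theta f) hu (mellinConvergent_theta ha hf _) ?_
    ((continuousOn_theta f).continuousAt (Ioi_mem_nhds hu)), h0]
  · simp [mellinInv]
  · rw [h0]
    simp [Complex.VerticalIntegrable]

theorem lintegral_Ioc_rpow {p t : ℝ} (hp : -1 < p) (ht : 0 < t) :
    ∫⁻ v in Ioc 0 t, ENNReal.ofReal (v ^ p) = ENNReal.ofReal (t ^ (p + 1) / (p + 1)) := by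
  have hi : IntegrableOn (fun v : ℝ => v ^ p) (Ioc 0 t) :=
    (intervalIntegrable_iff_integrableOn_Ioc_of_le ht.le).1
      (intervalIntegral.intervalIntegrable_rpow' hp)
  rw [← ofReal_integral_eq_lintegral_ofReal hi, ← intervalIntegral.integral_of_le ht.le,
    integral_rpow (Or.inl hp), Real.zero_rpow (by linarith), sub_zero]
  filter_upwards [ae_restrict_mem measurableSet_Ioc] with v hv
  exact Real.rpow_nonneg hv.1.le _

theorem lintegral_Ioi_rpow {p t : ℝ} (hp : p < -1) (ht : 0 < t) :
    ∫⁻ v in Ioi t, ENNReal.ofReal (v ^ p) = ENNReal.ofReal (-t ^ (p + 1) / (p + 1)) := by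
  rw [← ofReal_integral_eq_lintegral_ofReal (integrableOn_Ioi_rpow_of_lt hp ht),
    integral_Ioi_rpow_of_lt hp ht]
  filter_upwards [ae_restrict_mem measurableSet_Ioi] with v hv
  exact Real.rpow_nonneg (ht.trans hv).le _

/-- The kernel `min 1 (t / v)`. -/
def hardyKernel (t v : ℝ) : ℝ := if v ≤ t then 1 else t / v

theorem measurable_hardyKernel : Measurable (Function.uncurry hardyKernel) :=
  Measurable.ite (measurableSet_le measurable_snd measurable_fst) measurable_const
    (measurable_fst.div measurable_snd)

theorem hardyKernel_nonneg {t v : ℝ} (ht : 0 < t) (hv : 0 < v) : 0 ≤ hardyKernel t v := by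
  unfold hardyKernel
  split_ifs <;> positivity

theorem lintegral_hardyKernel_right {t : ℝ} (ht : 0 < t) :
    ∫⁻ v in Ioi (0 : ℝ), ENNReal.ofReal (v ^ (-(1 / 2) : ℝ) * hardyKernel t v ^ 2)
      ≤ ENNReal.ofReal (4 * t ^ (1 / 2 : ℝ)) := by
  rw [← Ioc_union_Ioi_eq_Ioi ht.le]
  refine (lintegral_union_le _ _ _).trans ?_
  have h1 : ∫⁻ v in Ioc 0 t, ENNReal.ofReal (v ^ (-(1 / 2) : ℝ) * hardyKernel t v ^ 2)
      = ENNReal.ofReal (2 * t ^ (1 / 2 : ℝ)) := by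
    rw [setLIntegral_congr_fun (g := fun v => ENNReal.ofReal (v ^ (-(1 / 2) : ℝ)))
      measurableSet_Ioc fun v hv => ?_, lintegral_Ioc_rpow (by norm_num) ht]
    · congr 1; norm_num; ring
    · simp only [hardyKernel, if_pos hv.2, one_pow, mul_one]
  have h2 : ∫⁻ v in Ioi t, ENNReal.ofReal (v ^ (-(1 / 2) : ℝ) * hardyKernel t v ^ 2)
      = ENNReal.ofReal (2 / 3 * t ^ (1 / 2 : ℝ)) := by
    rw [setLIntegral_congr_fun
      (g := fun v => ENNReal.ofReal (t ^ 2) * ENNReal.ofReal (v ^ (-(5 / 2) : ℝ)))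
      measurableSet_Ioi fun v hv => ?_, lintegral_const_mul _ (by fun_prop),
      lintegral_Ioi_rpow (by norm_num) ht, ← ENNReal.ofReal_mul (by positivity)]
    · congr 1
      have e : t ^ (1 / 2 : ℝ) = t ^ 2 * t ^ (-(3 / 2) : ℝ) := by
        rw [← Real.rpow_two, ← Real.rpow_add ht]
        norm_num
      rw [e, show (-(5 / 2) : ℝ) + 1 = -(3 / 2) by norm_num]
      ring
    · have hv0 : 0 < v := ht.trans hv
      simp only
      rw [← ENNReal.ofReal_mul (by positivity)]
      congr 1
      simp only [hardyKernel, if_neg (not_le.2 (mem_Ioi.1 hv))]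
      rw [show (-(5 / 2) : ℝ) = -(1 / 2) - 2 by norm_num, Real.rpow_sub hv0, Real.rpow_two]
      ring
  rw [h1, h2, ← ENNReal.ofReal_add (by positivity) (by positivity)]
  refine ENNReal.ofReal_le_ofReal ?_
  have := Real.rpow_nonneg ht.le (1 / 2)
  linarith

theorem lintegral_hardyKernel_left {v : ℝ} (hv : 0 < v) :
    ∫⁻ t in Ioi (0 : ℝ), ENNReal.ofReal (t ^ (-(3 / 2) : ℝ) * hardyKernel t v ^ 2)
      ≤ ENNReal.ofReal (4 * v ^ (-(1 / 2) : ℝ)) := by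
  rw [← Ioc_union_Ioi_eq_Ioi hv.le]
  refine (lintegral_union_le _ _ _).trans ?_
  have h1 : ∫⁻ t in Ioc 0 v, ENNReal.ofReal (t ^ (-(3 / 2) : ℝ) * hardyKernel t v ^ 2)
      ≤ ENNReal.ofReal (2 / 3 * v ^ (-(1 / 2) : ℝ)) := by
    rw [setLIntegral_congr_fun
      (g := fun t => ENNReal.ofReal (v ^ (-2 : ℝ)) * ENNReal.ofReal (t ^ (1 / 2 : ℝ)))
      measurableSet_Ioc fun t ht => ?_, lintegral_const_mul _ (by fun_prop),
      lintegral_Ioc_rpow (by norm_num) hv, ← ENNReal.ofReal_mul (by positivity)]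
    · refine ENNReal.ofReal_le_ofReal (le_of_eq ?_)
      have e : v ^ (-(1 / 2) : ℝ) = v ^ (-2 : ℝ) * v ^ (3 / 2 : ℝ) := by
        rw [← Real.rpow_add hv]
        norm_num
      rw [e, show (1 / 2 : ℝ) + 1 = 3 / 2 by norm_num]
      ring
    · simp only
      rw [← ENNReal.ofReal_mul (by positivity)]
      congr 1
      rw [show (1 / 2 : ℝ) = -(3 / 2) + 2 by norm_num, Real.rpow_add ht.1, Real.rpow_two,
        Real.rpow_neg hv.le, Real.rpow_two]
      rcases ht.2.eq_or_lt with rfl | h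
      · simp only [hardyKernel, le_refl, if_true]
        have := ht.1
        field_simp
      · simp only [hardyKernel, if_neg (not_le.2 h)]
        rw [div_pow]
        ring
  have h2 : ∫⁻ t in Ioi v, ENNReal.ofReal (t ^ (-(3 / 2) : ℝ) * hardyKernel t v ^ 2)
      = ENNReal.ofReal (2 * v ^ (-(1 / 2) : ℝ)) := by
    rw [setLIntegral_congr_fun (g := fun t => ENNReal.ofReal (t ^ (-(3 / 2) : ℝ)))
      measurableSet_Ioi fun t ht => ?_, lintegral_Ioi_rpow (by norm_num) hv]
    · congr 1; norm_num; ring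
    · simp only [hardyKernel, if_pos (le_of_lt (mem_Ioi.1 ht)), one_pow, mul_one]
  rw [h2]
  refine (add_le_add_left h1 _).trans ?_
  rw [← ENNReal.ofReal_add (by positivity) (by positivity)]
  refine ENNReal.ofReal_le_ofReal ?_
  have := Real.rpow_nonneg hv.le (-(1 / 2))
  linarith

/-- Schur's test for the operator with kernel `t⁻¹ min (1, t / v) ^ 2` on `L²(0, ∞)`. -/
theorem lintegral_hardyOperator_sq_lt_top (f : HalfLineL2) :
    ∫⁻ t in Ioi (0 : ℝ), (ENNReal.ofReal t⁻¹ *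
      ∫⁻ v in Ioi (0 : ℝ), ‖f v‖ₑ * ENNReal.ofReal (hardyKernel t v ^ 2)) ^ (2 : ℝ) < ∞ := by
  have hfm : Measurable f := (Lp.stronglyMeasurable f).measurable
  have hk : ∀ t, Measurable fun v => hardyKernel t v := fun t =>
    measurable_hardyKernel.comp (measurable_const.prodMk measurable_id)
  have hk' : Measurable fun p : ℝ × ℝ => hardyKernel p.1 p.2 := measurable_hardyKernel
  have h1 : ∀ t ∈ Ioi (0 : ℝ), (ENNReal.ofReal t⁻¹ *
      ∫⁻ v in Ioi (0 : ℝ), ‖f v‖ₑ * ENNReal.ofReal (hardyKernel t v ^ 2)) ^ (2 : ℝ)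
      ≤ 4 * ∫⁻ v in Ioi (0 : ℝ), ‖f v‖ₑ ^ (2 : ℝ) * (ENNReal.ofReal (v ^ (1 / 2 : ℝ)) *
        ENNReal.ofReal (t ^ (-(3 / 2) : ℝ) * hardyKernel t v ^ 2)) := fun t ht => by
    rw [mem_Ioi] at ht
    have hcs := ENNReal.lintegral_mul_le_Lp_mul_Lq (volume.restrict (Ioi (0 : ℝ)))
      Real.HolderConjugate.two_two
      (f := fun v => ‖f v‖ₑ * ENNReal.ofReal (v ^ (1 / 4 : ℝ) * hardyKernel t v))
      (g := fun v => ENNReal.ofReal (v ^ (-(1 / 4) : ℝ) * hardyKernel t v))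
      (by have := hk t; fun_prop) (by have := hk t; fun_prop)
    have e1 : ∫⁻ v in Ioi (0 : ℝ), ‖f v‖ₑ * ENNReal.ofReal (hardyKernel t v ^ 2)
        = ∫⁻ v in Ioi (0 : ℝ), ((fun v => ‖f v‖ₑ * ENNReal.ofReal (v ^ (1 / 4 : ℝ) * hardyKernel t v))
          * (fun v => ENNReal.ofReal (v ^ (-(1 / 4) : ℝ) * hardyKernel t v))) v := by
      refine setLIntegral_congr_fun measurableSet_Ioi fun v hv => ?_
      rw [mem_Ioi] at hv
      have := hardyKernel_nonneg ht hv
      rw [Pi.mul_apply, mul_assoc, ← ENNReal.ofReal_mul (by positivity)]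
      congr 2
      rw [mul_mul_mul_comm, ← Real.rpow_add hv]
      norm_num
      ring
    have e2 : ∫⁻ v in Ioi (0 : ℝ), (ENNReal.ofReal (v ^ (-(1 / 4) : ℝ) * hardyKernel t v)) ^ (2 : ℝ)
        ≤ ENNReal.ofReal (4 * t ^ (1 / 2 : ℝ)) := by
      refine le_trans (le_of_eq ?_) (lintegral_hardyKernel_right ht)
      refine setLIntegral_congr_fun measurableSet_Ioi fun v hv => ?_
      rw [mem_Ioi] at hv
      have := hardyKernel_nonneg ht hv
      rw [ENNReal.rpow_two, ← ENNReal.ofReal_pow (by positivity), mul_pow, ← Real.rpow_natCast,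
        ← Real.rpow_mul hv.le]
      norm_num
    have e3 : ∫⁻ v in Ioi (0 : ℝ),
          (‖f v‖ₑ * ENNReal.ofReal (v ^ (1 / 4 : ℝ) * hardyKernel t v)) ^ (2 : ℝ)
        = ∫⁻ v in Ioi (0 : ℝ), ‖f v‖ₑ ^ (2 : ℝ) *
          ENNReal.ofReal (v ^ (1 / 2 : ℝ) * hardyKernel t v ^ 2) := by
      refine setLIntegral_congr_fun measurableSet_Ioi fun v hv => ?_
      rw [mem_Ioi] at hv
      have := hardyKernel_nonneg ht hv
      rw [ENNReal.mul_rpow_of_nonneg _ _ zero_le_two, ENNReal.rpow_two, ENNReal.rpow_two,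
        ← ENNReal.ofReal_pow (by positivity), mul_pow,
        ← Real.rpow_natCast (v ^ (1 / 4 : ℝ)), ← Real.rpow_mul hv.le]
      norm_num
    rw [← e1, e3] at hcs
    calc _ = ENNReal.ofReal t⁻¹ ^ (2 : ℝ) *
          (∫⁻ v in Ioi (0 : ℝ), ‖f v‖ₑ * ENNReal.ofReal (hardyKernel t v ^ 2)) ^ (2 : ℝ) :=
          ENNReal.mul_rpow_of_nonneg _ _ zero_le_two
      _ ≤ ENNReal.ofReal t⁻¹ ^ (2 : ℝ) * ((∫⁻ v in Ioi (0 : ℝ), ‖f v‖ₑ ^ (2 : ℝ) *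
          ENNReal.ofReal (v ^ (1 / 2 : ℝ) * hardyKernel t v ^ 2))
            * ENNReal.ofReal (4 * t ^ (1 / 2 : ℝ))) := by
          gcongr
          refine (ENNReal.rpow_le_rpow hcs zero_le_two).trans ?_
          rw [ENNReal.mul_rpow_of_nonneg _ _ zero_le_two, ← ENNReal.rpow_mul, ← ENNReal.rpow_mul]
          norm_num
          gcongr
          simpa using e2
      _ = ENNReal.ofReal (4 * t ^ (-(3 / 2) : ℝ)) * (∫⁻ v in Ioi (0 : ℝ), ‖f v‖ₑ ^ (2 : ℝ) *
          ENNReal.ofReal (v ^ (1 / 2 : ℝ) * hardyKernel t v ^ 2)) := by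
          rw [mul_left_comm, mul_comm, ENNReal.rpow_two, ← ENNReal.ofReal_pow (by positivity),
            ← ENNReal.ofReal_mul (by positivity)]
          congr 2
          rw [show (-(3 / 2) : ℝ) = 1 / 2 - 2 by norm_num, Real.rpow_sub ht, Real.rpow_two]
          field_simp
      _ = _ := by
          rw [ENNReal.ofReal_mul (by norm_num), mul_assoc]
          congr 1
          · norm_num
          rw [← lintegral_const_mul _ (by have := hk t; fun_prop)]
          refine setLIntegral_congr_fun measurableSet_Ioi fun v hv => ?_
          rw [mem_Ioi] at hv
          rw [mul_left_comm, ← ENNReal.ofReal_mul (by positivity),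
            ← ENNReal.ofReal_mul (by positivity)]
          congr 2
          ring
  refine (setLIntegral_mono_ae' measurableSet_Ioi (ae_of_all _ h1)).trans_lt ?_
  have hmeas : Measurable fun p : ℝ × ℝ => ‖f p.2‖ₑ ^ (2 : ℝ) *
      (ENNReal.ofReal (p.2 ^ (1 / 2 : ℝ)) *
        ENNReal.ofReal (p.1 ^ (-(3 / 2) : ℝ) * hardyKernel p.1 p.2 ^ 2)) := by
    fun_prop
  rw [lintegral_const_mul' _ _ (by norm_num), lintegral_lintegral_swap hmeas.aemeasurable]
  refine ENNReal.mul_lt_top (by norm_num) ?_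
  have h2 : ∀ v ∈ Ioi (0 : ℝ), ∫⁻ t in Ioi (0 : ℝ), ‖f v‖ₑ ^ (2 : ℝ) *
      (ENNReal.ofReal (v ^ (1 / 2 : ℝ)) *
        ENNReal.ofReal (t ^ (-(3 / 2) : ℝ) * hardyKernel t v ^ 2)) ≤ ‖f v‖ₑ ^ (2 : ℝ) * 4 :=
    fun v hv => by
      rw [mem_Ioi] at hv
      have hkv : Measurable fun t => hardyKernel t v :=
        measurable_hardyKernel.comp (measurable_id.prodMk measurable_const)
      rw [lintegral_const_mul _ (by fun_prop), lintegral_const_mul _ (by fun_prop)]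
      gcongr
      calc _ ≤ ENNReal.ofReal (v ^ (1 / 2 : ℝ)) * ENNReal.ofReal (4 * v ^ (-(1 / 2) : ℝ)) := by
            gcongr
            exact lintegral_hardyKernel_left hv
        _ = 4 := by
            rw [← ENNReal.ofReal_mul (by positivity), mul_left_comm, ← Real.rpow_add hv]
            norm_num
  refine (setLIntegral_mono_ae' measurableSet_Ioi (ae_of_all _ h2)).trans_lt ?_
  rw [lintegral_mul_const' _ _ (by norm_num)]
  refine ENNReal.mul_lt_top ?_ (by norm_num)
  have := lintegral_rpow_enorm_lt_top_of_eLpNorm_lt_top (by norm_num) (by norm_num)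
    (Lp.eLpNorm_lt_top f)
  simpa using this

/-- The primitive `t ↦ ∫_0^t f(v) v^{-w} dv`. -/
def mellinPrimitive (f : HalfLineL2) (w : ℂ) (t : ℝ) : ℂ :=
  ∫ v in Ioc 0 t, f v * (v : ℂ) ^ (-w)

theorem measurable_mul_cpow (f : HalfLineL2) (w : ℂ) :
    Measurable fun v : ℝ => f v * (v : ℂ) ^ (-w) :=
  (Lp.stronglyMeasurable f).measurable.mul (by fun_prop)

theorem mellinPrimitive_eq_indicator (f : HalfLineL2) (w : ℂ) (t : ℝ) :
    mellinPrimitive f w t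
      = ∫ v in Ioi (0 : ℝ), (Iic t).indicator (fun v => f v * (v : ℂ) ^ (-w)) v := by
  rw [setIntegral_indicator measurableSet_Iic, Ioi_inter_Iic]; rfl

theorem stronglyMeasurable_mellinPrimitive (f : HalfLineL2) (w : ℂ) :
    StronglyMeasurable (mellinPrimitive f w) := by
  have h : Measurable (Function.uncurry fun t v : ℝ =>
      (Iic t).indicator (fun v => f v * (v : ℂ) ^ (-w)) v) :=
    Measurable.ite (measurableSet_le measurable_snd measurable_fst)
      ((measurable_mul_cpow f w).comp measurable_snd) measurable_const
  have := h.stronglyMeasurable.integral_prod_right (ν := volume.restrict (Ioi (0 : ℝ)))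
  convert this using 2 with t
  exact mellinPrimitive_eq_indicator f w t

theorem integrableOn_Ioc_mul_cpow {a : ℝ} (ha : 0 < a) {f : HalfLineL2} (hf : f ∈ vanishingBelow a)
    {w : ℂ} (hw : 0 ≤ w.re) (t : ℝ) :
    IntegrableOn (fun v => f v * (v : ℂ) ^ (-w)) (Ioc 0 t) := by
  have hf' : ∀ᵐ t ∂volume.restrict (Ioi (0 : ℝ)), t < a → f t = 0 := hf
  have hle : volume.restrict (Ioc 0 t) ≤ volume.restrict (Ioi (0 : ℝ)) :=
    Measure.restrict_mono Ioc_subset_Ioi_self le_rfl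
  have h1 : Integrable f (volume.restrict (Ioc 0 t)) :=
    ((Lp.memLp f).mono_measure hle).integrable (by norm_num)
  refine (h1.norm.const_mul (a ^ (-w.re))).mono' (measurable_mul_cpow f w).aestronglyMeasurable ?_
  filter_upwards [ae_mono hle hf', ae_restrict_mem measurableSet_Ioc] with v h2 hv
  rcases lt_or_ge v a with h | h
  · rw [h2 h]; simp
  · rw [norm_mul, Complex.norm_cpow_eq_rpow_re_of_pos hv.1, mul_comm, Complex.neg_re]
    exact mul_le_mul_of_nonneg_right (Real.rpow_le_rpow_of_nonpos ha h (by linarith))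
      (norm_nonneg _)

theorem norm_cpow_mul_gaussian_le {v u : ℝ} (hv : 0 < v) (hu : 0 < u) (w : ℂ) (n : ℕ) :
    ‖(u : ℂ) ^ (w / 2 - 1) * (Real.exp (-Real.pi * u * v ^ 2) : ℂ)‖
      ≤ n.factorial / (Real.pi * v ^ 2) ^ n * u ^ (w.re / 2 - 1 - n) := by
  have := Real.pi_pos
  rw [norm_cpow_mul_exp hu, Real.rpow_sub hu _ (n : ℝ), Real.rpow_natCast]
  calc _ ≤ u ^ (w.re / 2 - 1) * (n.factorial / (Real.pi * v ^ 2) ^ n * (u ^ n)⁻¹) := by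
        gcongr
        exact exp_neg_mul_le (by positivity) n hu
    _ = _ := by ring

theorem integral_norm_cpow_mul_gaussian_Ioi_le {v T : ℝ} (hv : 0 < v) (hT : 0 < T) (w : ℂ) {n : ℕ}
    (hn : w.re / 2 < n) :
    ∫ u in Ioi T, ‖(u : ℂ) ^ (w / 2 - 1) * (Real.exp (-Real.pi * u * v ^ 2) : ℂ)‖
      ≤ n.factorial / (Real.pi * v ^ 2) ^ n * (T ^ (w.re / 2 - n) / (n - w.re / 2)) := by
  have hlt : w.re / 2 - 1 - n < -1 := by linarith
  have h : ∫ u in Ioi T, n.factorial / (Real.pi * v ^ 2) ^ n * u ^ (w.re / 2 - 1 - n)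
      = n.factorial / (Real.pi * v ^ 2) ^ n * (T ^ (w.re / 2 - n) / (n - w.re / 2)) := by
    rw [integral_const_mul, integral_Ioi_rpow_of_lt hlt hT,
      show w.re / 2 - 1 - n + 1 = w.re / 2 - n by ring, neg_div, ← div_neg, neg_sub]
  rw [← h]
  refine integral_mono_of_nonneg (ae_of_all _ fun _ => norm_nonneg _)
    ((integrableOn_Ioi_rpow_of_lt hlt hT).const_mul _) ?_
  filter_upwards [ae_restrict_mem measurableSet_Ioi] with u hu
  exact norm_cpow_mul_gaussian_le hv (hT.trans hu) w n

theorem norm_integral_cpow_mul_gaussian_Ioc_le {v T : ℝ} (hT : 0 < T) {w : ℂ} (hw : 0 < w.re) :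
    ‖∫ u in Ioc 0 T, (u : ℂ) ^ (w / 2 - 1) * (Real.exp (-Real.pi * u * v ^ 2) : ℂ)‖
      ≤ 2 / w.re * T ^ (w.re / 2) := by
  have hlt : -1 < w.re / 2 - 1 := by linarith
  have h : ∫ u in Ioc 0 T, u ^ (w.re / 2 - 1) = 2 / w.re * T ^ (w.re / 2) := by
    rw [← intervalIntegral.integral_of_le hT.le, integral_rpow (Or.inl hlt), sub_add_cancel,
      Real.zero_rpow (by positivity)]
    field_simp
    ring
  rw [← h]
  refine norm_integral_le_of_norm_le ((intervalIntegrable_iff_integrableOn_Ioc_of_le hT.le).1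
      (intervalIntegral.intervalIntegrable_rpow' hlt)) ?_
  filter_upwards [ae_restrict_mem measurableSet_Ioc] with u hu
  rw [norm_cpow_mul_exp hu.1]
  have := Real.rpow_nonneg hu.1.le (w.re / 2 - 1)
  refine mul_le_of_le_one_right this (Real.exp_le_one_iff.2 ?_)
  have := Real.pi_pos
  have := hu.1
  rw [neg_nonpos]
  positivity

theorem integrable_gaussian_kernel {a : ℝ} (ha : 0 < a) {f : HalfLineL2}
    (hf : f ∈ vanishingBelow a) {w : ℂ} (hw : 0 < w.re) {T : ℝ} (hT : 0 < T) :
    Integrable (Function.uncurry fun v u : ℝ =>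
        f v * ((u : ℂ) ^ (w / 2 - 1) * (Real.exp (-Real.pi * u * v ^ 2) : ℂ)))
      ((volume.restrict (Ioi (0 : ℝ))).prod (volume.restrict (Ioi T))) := by
  have hm : AEStronglyMeasurable (Function.uncurry fun v u : ℝ =>
        f v * ((u : ℂ) ^ (w / 2 - 1) * (Real.exp (-Real.pi * u * v ^ 2) : ℂ)))
      ((volume.restrict (Ioi (0 : ℝ))).prod (volume.restrict (Ioi T))) := by
    refine AEStronglyMeasurable.mul (Lp.aestronglyMeasurable f).comp_fst ?_
    exact (by fun_prop : Measurable fun p : ℝ × ℝ =>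
      ((p.2 : ℂ) ^ (w / 2 - 1) * (Real.exp (-Real.pi * p.2 * p.1 ^ 2) : ℂ))).aestronglyMeasurable
  obtain ⟨n, hn⟩ := exists_nat_gt (max (w.re / 2) 1)
  have hn1 : w.re / 2 < n := (le_max_left _ _).trans_lt hn
  have hn2 : (1 : ℝ) < n := (le_max_right _ _).trans_lt hn
  rw [integrable_prod_iff hm]
  constructor
  · filter_upwards [ae_restrict_mem measurableSet_Ioi] with v hv
    exact ((integrableOn_cpow_mul_gaussian hv hw).mono_set (Ioi_subset_Ioi hT.le)).const_mul (f v)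
  · refine ((integrable_mul_cpow ha hf (s := 2 * n) (by simp; linarith)).norm.const_mul
      (n.factorial / Real.pi ^ n * (T ^ (w.re / 2 - n) / (n - w.re / 2)))).mono'
      hm.norm.integral_prod_right' ?_
    filter_upwards [ae_restrict_mem measurableSet_Ioi] with v hv
    rw [Real.norm_of_nonneg (integral_nonneg fun _ => norm_nonneg _)]
    simp only [Function.uncurry, norm_mul (f v)]
    rw [integral_const_mul]
    refine (mul_le_mul_of_nonneg_left (integral_norm_cpow_mul_gaussian_Ioi_le hv hT w hn1)
      (norm_nonneg _)).trans (le_of_eq ?_)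
    have hv0 : 0 < v := hv
    rw [Complex.norm_cpow_eq_rpow_re_of_pos hv0]
    have : v ^ (-(2 * (n : ℂ))).re = ((v ^ 2) ^ n)⁻¹ := by
      rw [← pow_mul, ← Real.rpow_natCast, ← Real.rpow_neg hv0.le]
      congr 1
      simp
    rw [this, mul_pow]
    field_simp

/-- Comparison of the primitive `∫_0^t f(v) v^{-w} dv` with the truncated Mellin transform
of `theta f`. -/
theorem exists_enorm_mellinPrimitive_sub_le {a : ℝ} (ha : 0 < a) {f : HalfLineL2}
    (hf : f ∈ vanishingBelow a) {w : ℂ} (hw : 0 < w.re) :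
    ∃ C : ℝ, 0 ≤ C ∧ ∀ t : ℝ, 0 < t →
      ‖(Real.pi : ℂ) ^ (-w / 2) * Complex.Gamma (w / 2) * mellinPrimitive f w t
        - ∫ u in Ioi (t ^ 2)⁻¹, (u : ℂ) ^ (w / 2 - 1) * theta f u‖ₑ
      ≤ ENNReal.ofReal (C * t ^ (-w.re)) *
        ∫⁻ v in Ioi (0 : ℝ), ‖f v‖ₑ * ENNReal.ofReal (hardyKernel t v ^ 2) := by
  obtain ⟨n, hn⟩ := exists_nat_gt (max (w.re / 2) 1)
  have hn1 : w.re / 2 < n := (le_max_left _ _).trans_lt hn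
  have hn2 : (1 : ℝ) < n := (le_max_right _ _).trans_lt hn
  have hpi := Real.pi_pos
  have hn3 : 0 < n - w.re / 2 := by linarith
  set D : ℝ := n.factorial / Real.pi ^ n / (n - w.re / 2)
  have hD : 0 ≤ D := by positivity
  refine ⟨2 / w.re + D, by positivity, fun t ht => ?_⟩
  set T := (t ^ 2)⁻¹ with hTdef
  have hT : 0 < T := by positivity
  have hTσ : ∀ x : ℝ, T ^ x = t ^ (-(2 * x)) := fun x => by
    rw [hTdef, ← Real.rpow_natCast, ← Real.rpow_neg ht.le, ← Real.rpow_mul ht.le]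
    congr 1
    push_cast
    ring
  set k : ℝ → ℝ → ℂ := fun v u => (u : ℂ) ^ (w / 2 - 1) * (Real.exp (-Real.pi * u * v ^ 2) : ℂ)
  have hK := integrable_gaussian_kernel ha hf hw hT
  have hA : ∫ u in Ioi T, (u : ℂ) ^ (w / 2 - 1) * theta f u
      = ∫ v in Ioi (0 : ℝ), f v * ∫ u in Ioi T, k v u := by
    refine Eq.trans ?_ ((integral_integral_swap hK).symm.trans ?_)
    · refine integral_congr_ae (ae_of_all _ fun u => ?_)
      simp only [theta]
      rw [← integral_const_mul]
      refine integral_congr_ae (ae_of_all _ fun v => ?_)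
      simp only
      ring
    · refine integral_congr_ae (ae_of_all _ fun v => ?_)
      simp only [k]
      rw [integral_const_mul]
  have hq : (Real.pi : ℂ) ^ (-w / 2) * Complex.Gamma (w / 2) * mellinPrimitive f w t
      = ∫ v in Ioi (0 : ℝ), (Iic t).indicator (fun v => f v * ∫ u in Ioi (0 : ℝ), k v u) v := by
    rw [mellinPrimitive, ← integral_const_mul, setIntegral_indicator measurableSet_Iic,
      Ioi_inter_Iic]
    refine setIntegral_congr_fun measurableSet_Ioc fun v hv => ?_
    simp only [k]
    rw [integral_cpow_mul_gaussian hv.1 hw]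
    ring
  have hi1 : IntegrableOn (fun v => (Iic t).indicator
      (fun v => f v * ∫ u in Ioi (0 : ℝ), k v u) v) (Ioi (0 : ℝ)) := by
    change Integrable ((Iic t).indicator (fun v => f v * ∫ u in Ioi (0 : ℝ), k v u)) _
    rw [integrable_indicator_iff measurableSet_Iic, IntegrableOn,
      Measure.restrict_restrict measurableSet_Iic, inter_comm, Ioi_inter_Iic]
    refine IntegrableOn.congr_fun ((integrableOn_Ioc_mul_cpow ha hf hw.le t).const_mul
      ((Real.pi : ℂ) ^ (-w / 2) * Complex.Gamma (w / 2))) (fun v hv => ?_) measurableSet_Ioc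
    simp only [k]
    rw [integral_cpow_mul_gaussian hv.1 hw]
    ring
  have hi2 : IntegrableOn (fun v => f v * ∫ u in Ioi T, k v u) (Ioi (0 : ℝ)) := by
    refine hK.integral_prod_left.congr (ae_of_all _ fun v => ?_)
    simp only [Function.uncurry, k]
    rw [integral_const_mul]
  rw [hA, hq, ← integral_sub hi1 hi2]
  refine (enorm_integral_le_lintegral_enorm _).trans ?_
  rw [← lintegral_const_mul' _ _ (by simp)]
  refine setLIntegral_mono_ae' measurableSet_Ioi (ae_of_all _ fun v hv => ?_)
  rw [mem_Ioi] at hv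
  rw [mul_left_comm, ← ENNReal.ofReal_mul (by positivity)]
  have hksplit : v ≤ t → (Iic t).indicator (fun v => f v * ∫ u in Ioi (0 : ℝ), k v u) v
      - f v * ∫ u in Ioi T, k v u = f v * ∫ u in Ioc 0 T, k v u := fun h => by
    have hki := integrableOn_cpow_mul_gaussian hv hw
    have hsp : ∫ u in Ioi (0 : ℝ), k v u = (∫ u in Ioc 0 T, k v u) + ∫ u in Ioi T, k v u := by
      rw [← setIntegral_union Ioc_disjoint_Ioi_same measurableSet_Ioi
        (hki.mono_set Ioc_subset_Ioi_self) (hki.mono_set (Ioi_subset_Ioi hT.le)),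
        Ioc_union_Ioi_eq_Ioi hT.le]
    rw [indicator_of_mem (mem_Iic.2 h), ← mul_sub, hsp, add_sub_cancel_right]
  have ht0 : 0 < t ^ (-w.re) := Real.rpow_pos_of_pos ht _
  rcases le_or_gt v t with h | h
  · rw [hksplit h, enorm_mul]
    gcongr
    rw [← ofReal_norm]
    refine ENNReal.ofReal_le_ofReal ((norm_integral_cpow_mul_gaussian_Ioc_le hT hw).trans ?_)
    rw [hTσ, hardyKernel, if_pos h, show 2 * (w.re / 2) = w.re by ring]
    have : 0 ≤ D * t ^ (-w.re) := by positivity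
    linarith
  · rw [indicator_of_notMem (by simpa using h), zero_sub, enorm_neg, enorm_mul]
    gcongr
    rw [← ofReal_norm]
    refine ENNReal.ofReal_le_ofReal ((norm_integral_le_integral_norm _).trans
      ((integral_norm_cpow_mul_gaussian_Ioi_le hv hT w hn1).trans ?_))
    rw [hTσ, hardyKernel, if_neg (not_le.2 h)]
    have h1 : t ^ (-(2 * (w.re / 2 - n))) = t ^ (-w.re) * (t ^ 2) ^ n := by
      rw [← pow_mul, ← Real.rpow_natCast, ← Real.rpow_add ht]
      congr 1
      push_cast
      ring
    have h2 : ((t / v) ^ 2) ^ n ≤ (t / v) ^ 2 := by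
      have h3 : (t / v) ^ 2 ≤ 1 := pow_le_one₀ (by positivity) ((div_le_one hv).2 h.le)
      exact pow_le_of_le_one (by positivity) h3 (by rintro rfl; norm_num at hn2)
    calc _ = D * t ^ (-w.re) * ((t / v) ^ 2) ^ n := by
          rw [h1, mul_pow, div_pow, div_pow]
          simp only [D]
          field_simp
      _ ≤ (2 / w.re + D) * t ^ (-w.re) * (t / v) ^ 2 := by
          gcongr
          have : 0 ≤ 2 / w.re := by positivity
          linarith

theorem mellinPrimitive_eq_zero {a : ℝ} {f : HalfLineL2} (hf : f ∈ vanishingBelow a) (w : ℂ)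
    {t : ℝ} (ht : t < a) : mellinPrimitive f w t = 0 := by
  have hf' : ∀ᵐ t ∂volume.restrict (Ioi (0 : ℝ)), t < a → f t = 0 := hf
  refine integral_eq_zero_of_ae ?_
  filter_upwards [ae_mono (Measure.restrict_mono Ioc_subset_Ioi_self le_rfl) hf',
    ae_restrict_mem measurableSet_Ioc] with v h1 hv
  rw [h1 (hv.2.trans_lt ht), zero_mul]; rfl

theorem gammaFactor_ne_zero {w : ℂ} (hw : 0 < w.re) :
    (Real.pi : ℂ) ^ (-w / 2) * Complex.Gamma (w / 2) ≠ 0 := by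
  refine mul_ne_zero ?_ (Complex.Gamma_ne_zero_of_re_pos (by simpa using hw))
  rw [ofReal_cpow_eq_exp Real.pi_pos]
  exact Complex.exp_ne_zero _

theorem exists_norm_truncated_mellin_le {a : ℝ} (ha : 0 < a) {f : HalfLineL2}
    (hf : f ∈ sonineSpace a) {w : ℂ} (hw : 0 < w.re) (h0 : thetaMellin f w = 0) :
    ∃ C : ℝ, 0 ≤ C ∧ ∀ t : ℝ, 0 < t →
      ‖∫ u in Ioi (t ^ 2)⁻¹, (u : ℂ) ^ (w / 2 - 1) * theta f u‖ ≤ C * t ^ (-w.re) := by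
  obtain ⟨C, hC0, hC⟩ := exists_norm_theta_le ha 0
  refine ⟨C * ‖f‖ * (2 / w.re), by positivity, fun t ht => ?_⟩
  set T := (t ^ 2)⁻¹ with hTdef
  have hT : 0 < T := by positivity
  have hconv : IntegrableOn (fun u : ℝ => (u : ℂ) ^ (w / 2 - 1) * theta f u) (Ioi 0) :=
    mellinConvergent_theta ha hf (w / 2)
  have h1 : (∫ u in Ioc 0 T, (u : ℂ) ^ (w / 2 - 1) * theta f u)
      + ∫ u in Ioi T, (u : ℂ) ^ (w / 2 - 1) * theta f u = 0 := by
    rw [← setIntegral_union Ioc_disjoint_Ioi_same measurableSet_Ioi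
      (hconv.mono_set Ioc_subset_Ioi_self) (hconv.mono_set (Ioi_subset_Ioi hT.le)),
      Ioc_union_Ioi_eq_Ioi hT.le]
    exact h0
  rw [eq_neg_of_add_eq_zero_right h1, norm_neg]
  have hlt : -1 < w.re / 2 - 1 := by linarith
  have h : ∫ u in Ioc 0 T, C * ‖f‖ * u ^ (w.re / 2 - 1) = C * ‖f‖ * (2 / w.re) * t ^ (-w.re) := by
    rw [integral_const_mul, ← intervalIntegral.integral_of_le hT.le, integral_rpow (Or.inl hlt),
      sub_add_cancel, Real.zero_rpow (by positivity)]
    have : T ^ (w.re / 2) = t ^ (-w.re) := by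
      rw [hTdef, ← Real.rpow_natCast, ← Real.rpow_neg ht.le, ← Real.rpow_mul ht.le]
      congr 1
      push_cast
      ring
    rw [this]
    field_simp
    ring
  rw [← h]
  refine norm_integral_le_of_norm_le (((intervalIntegrable_iff_integrableOn_Ioc_of_le hT.le).1
      (intervalIntegral.intervalIntegrable_rpow' hlt)).const_mul _) ?_
  filter_upwards [ae_restrict_mem measurableSet_Ioc] with u hu
  have h2 := (hC f hf u hu.1).1
  rw [pow_zero, mul_one] at h2
  rw [norm_mul, Complex.norm_cpow_eq_rpow_re_of_pos hu.1, mul_comm]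
  have h3 := Real.rpow_nonneg hu.1.le (w.re / 2 - 1)
  simp only [Complex.sub_re, Complex.div_ofNat_re, Complex.one_re]
  gcongr

theorem memLp_mellinDivision {a : ℝ} (ha : 0 < a) {f : HalfLineL2} (hf : f ∈ sonineSpace a)
    {w : ℂ} (hw : 0 < w.re) (h0 : thetaMellin f w = 0) :
    MemLp (fun t : ℝ => (t : ℂ) ^ (w - 1) * mellinPrimitive f w t) 2
      (volume.restrict (Ioi (0 : ℝ))) := by
  have hfv := (mem_sonineSpace.1 hf).1
  set γ := (Real.pi : ℂ) ^ (-w / 2) * Complex.Gamma (w / 2)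
  have hγ : γ ≠ 0 := gammaFactor_ne_zero hw
  obtain ⟨C1, hC1, h1⟩ := exists_norm_truncated_mellin_le ha hf hw h0
  obtain ⟨C2, hC2, h2⟩ := exists_enorm_mellinPrimitive_sub_le ha hfv hw
  have hm : StronglyMeasurable fun t : ℝ => (t : ℂ) ^ (w - 1) * mellinPrimitive f w t :=
    (by fun_prop : Measurable fun t : ℝ => (t : ℂ) ^ (w - 1)).stronglyMeasurable.mul
      (stronglyMeasurable_mellinPrimitive f w)
  suffices h : MemLp (fun t : ℝ => γ * ((t : ℂ) ^ (w - 1) * mellinPrimitive f w t)) 2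
      (volume.restrict (Ioi (0 : ℝ))) by
    have := h.const_mul γ⁻¹
    simpa [← mul_assoc, inv_mul_cancel₀ hγ] using this
  refine ⟨(hm.const_mul γ).aestronglyMeasurable, ?_⟩
  have hp := (memLp_indicator_cpow ha (s := 1) (by norm_num)).const_mul (C1 : ℂ)
  set p : ℝ → ℂ := fun t => (C1 : ℂ) * (Ici a).indicator (fun t : ℝ => (t : ℂ) ^ (-(1 : ℂ))) t
  set Q : ℝ → ℝ≥0∞ := fun t => ENNReal.ofReal t⁻¹ *
      ∫⁻ v in Ioi (0 : ℝ), ‖f v‖ₑ * ENNReal.ofReal (hardyKernel t v ^ 2)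
  have hbound : ∀ t ∈ Ioi (0 : ℝ), ‖γ * ((t : ℂ) ^ (w - 1) * mellinPrimitive f w t)‖ₑ ^ (2 : ℝ)
      ≤ 2 * ‖p t‖ₑ ^ (2 : ℝ) + 2 * (ENNReal.ofReal C2 ^ (2 : ℝ) * Q t ^ (2 : ℝ)) := fun t ht => by
    rw [mem_Ioi] at ht
    suffices h : ‖γ * ((t : ℂ) ^ (w - 1) * mellinPrimitive f w t)‖ₑ
        ≤ ‖p t‖ₑ + ENNReal.ofReal C2 * Q t by
      refine (ENNReal.rpow_le_rpow h zero_le_two).trans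
        ((ENNReal.rpow_add_le_mul_rpow_add_rpow _ _ one_le_two).trans (le_of_eq ?_))
      rw [mul_add, ENNReal.mul_rpow_of_nonneg _ _ zero_le_two]
      norm_num
    rcases lt_or_ge t a with hta | hta
    · rw [mellinPrimitive_eq_zero hfv w hta]
      simp
    · set A := ∫ u in Ioi (t ^ 2)⁻¹, (u : ℂ) ^ (w / 2 - 1) * theta f u
      have e1 : γ * ((t : ℂ) ^ (w - 1) * mellinPrimitive f w t)
          = (t : ℂ) ^ (w - 1) * A + (t : ℂ) ^ (w - 1) * (γ * mellinPrimitive f w t - A) := by ring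
      have e2 : ‖(t : ℂ) ^ (w - 1)‖ₑ = ENNReal.ofReal (t ^ (w.re - 1)) := by
        rw [← ofReal_norm, Complex.norm_cpow_eq_rpow_re_of_pos ht]
        simp
      have e3 : t ^ (w.re - 1) * t ^ (-w.re) = t⁻¹ := by
        rw [← Real.rpow_add ht, ← Real.rpow_neg_one]
        congr 1
        ring
      rw [e1]
      refine (enorm_add_le _ _).trans (add_le_add ?_ ?_)
      · rw [← ofReal_norm, ← ofReal_norm]
        refine ENNReal.ofReal_le_ofReal ?_
        simp only [p]
        rw [indicator_of_mem (mem_Ici.2 hta), norm_mul, norm_mul,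
          Complex.norm_cpow_eq_rpow_re_of_pos ht, Complex.norm_cpow_eq_rpow_re_of_pos ht,
          Complex.norm_real, Real.norm_of_nonneg hC1]
        calc _ ≤ t ^ (w.re - 1) * (C1 * t ^ (-w.re)) := by
              simp only [Complex.sub_re, Complex.one_re]
              gcongr
              exact h1 t ht
          _ = C1 * (t ^ (w.re - 1) * t ^ (-w.re)) := by ring
          _ = _ := by
              rw [e3, ← Real.rpow_neg_one]
              simp
      · rw [enorm_mul, e2]
        calc _ ≤ ENNReal.ofReal (t ^ (w.re - 1)) * (ENNReal.ofReal (C2 * t ^ (-w.re)) *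
              ∫⁻ v in Ioi (0 : ℝ), ‖f v‖ₑ * ENNReal.ofReal (hardyKernel t v ^ 2)) := by
              gcongr
              exact h2 t ht
          _ = _ := by
              rw [← mul_assoc, ← ENNReal.ofReal_mul (by positivity), mul_left_comm, e3,
                ENNReal.ofReal_mul hC2, mul_assoc]
  rw [eLpNorm_lt_top_iff_lintegral_rpow_enorm_lt_top (by norm_num) (by norm_num)]
  simp only [ENNReal.toReal_ofNat]
  refine (setLIntegral_mono_ae' measurableSet_Ioi (ae_of_all _ hbound)).trans_lt ?_
  rw [lintegral_add_left' ((hp.1.enorm.pow_const _).const_mul _), lintegral_const_mul' _ _ (by simp),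
    lintegral_const_mul' _ _ (by simp), lintegral_const_mul' _ _ (by simp)]
  refine ENNReal.add_lt_top.2 ⟨ENNReal.mul_lt_top (by simp) ?_,
    ENNReal.mul_lt_top (by simp) (ENNReal.mul_lt_top (by simp) ?_)⟩
  · simpa using lintegral_rpow_enorm_lt_top_of_eLpNorm_lt_top (by norm_num) (by norm_num) hp.2
  · exact lintegral_hardyOperator_sq_lt_top f

theorem rightMellin_mellinDivision {a : ℝ} (ha : 0 < a) {f : HalfLineL2}
    (hf : f ∈ vanishingBelow a) {w s : ℂ} (hs : 1 / 2 < s.re) (hws : w.re < s.re) :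
    ∫ t in Ioi (0 : ℝ), ((t : ℂ) ^ (w - 1) * mellinPrimitive f w t) * (t : ℂ) ^ (-s)
      = rightMellin f s / (s - w) := by
  have hre : (w - 1 - s).re < -1 := by simp; linarith
  have hne : s - w ≠ 0 := fun h => by
    rw [sub_eq_zero] at h
    rw [h] at hws
    exact lt_irrefl _ hws
  set K : ℝ → ℝ → ℂ := fun v t => (f v * (v : ℂ) ^ (-w)) *
    (Ici v).indicator (fun t : ℝ => (t : ℂ) ^ (w - 1 - s)) t
  have hKm : Measurable (Function.uncurry K) := by
    refine ((measurable_mul_cpow f w).comp measurable_fst).mul ?_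
    exact Measurable.ite (measurableSet_le measurable_fst measurable_snd)
      (by fun_prop : Measurable fun p : ℝ × ℝ => (p.2 : ℂ) ^ (w - 1 - s)) measurable_const
  have hset : ∀ v ∈ Ioi (0 : ℝ), Ioi 0 ∩ Ici v = Ici v := fun v hv =>
    inter_eq_right.2 fun t ht => mem_Ioi.2 (lt_of_lt_of_le (mem_Ioi.1 hv) (mem_Ici.1 ht))
  have hK : Integrable (Function.uncurry K)
      ((volume.restrict (Ioi (0 : ℝ))).prod (volume.restrict (Ioi (0 : ℝ)))) := by
    rw [integrable_prod_iff hKm.aestronglyMeasurable]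
    constructor
    · filter_upwards [ae_restrict_mem measurableSet_Ioi] with v hv
      suffices h : Integrable ((Ici v).indicator fun t : ℝ => (t : ℂ) ^ (w - 1 - s))
          (volume.restrict (Ioi 0)) from h.const_mul (f v * (v : ℂ) ^ (-w))
      rw [integrable_indicator_iff measurableSet_Ici, IntegrableOn,
        Measure.restrict_restrict measurableSet_Ici, inter_comm, hset v hv]
      change IntegrableOn _ _ _
      rw [integrableOn_Ici_iff_integrableOn_Ioi]
      exact integrableOn_Ioi_cpow_of_lt hre hv
    · refine ((integrable_mul_cpow ha hf hs).norm.const_mul (s.re - w.re)⁻¹).congr ?_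
      filter_upwards [ae_restrict_mem measurableSet_Ioi] with v hv
      have h1 : ∀ t ∈ Ioi (0 : ℝ), ‖Function.uncurry K (v, t)‖ = ‖f v * (v : ℂ) ^ (-w)‖ *
          (Ici v).indicator (fun t : ℝ => t ^ (w.re - 1 - s.re)) t := fun t ht => by
        simp only [Function.uncurry, K]
        rw [norm_mul _ (indicator _ _ _)]
        congr 1
        by_cases h : t ∈ Ici v
        · rw [indicator_of_mem h, indicator_of_mem h, Complex.norm_cpow_eq_rpow_re_of_pos ht]
          simp
        · rw [indicator_of_notMem h, indicator_of_notMem h, norm_zero]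
      have hv0 : 0 < v := hv
      rw [setIntegral_congr_fun measurableSet_Ioi h1, integral_const_mul,
        setIntegral_indicator measurableSet_Ici, hset v hv, integral_Ici_eq_integral_Ioi,
        integral_Ioi_rpow_of_lt (by linarith) hv0, norm_mul, norm_mul,
        Complex.norm_cpow_eq_rpow_re_of_pos hv0, Complex.norm_cpow_eq_rpow_re_of_pos hv0]
      have : v ^ (-s).re = v ^ (-w).re * v ^ (w.re - 1 - s.re + 1) := by
        rw [← Real.rpow_add hv0]
        congr 1
        simp
        ring
      rw [this]
      have h3 : s.re - w.re ≠ 0 := by linarith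
      have h4 : w.re - 1 - s.re + 1 = -(s.re - w.re) := by ring
      rw [h4, div_neg, neg_div, neg_neg]
      field_simp
  refine Eq.trans ?_ ((integral_integral_swap hK).symm.trans ?_)
  · refine setIntegral_congr_fun measurableSet_Ioi fun t ht => ?_
    simp only [K]
    have ht0 : (t : ℂ) ≠ 0 := by exact_mod_cast (ne_of_gt ht)
    rw [mellinPrimitive_eq_indicator, mul_right_comm, ← Complex.cpow_add _ _ ht0,
      ← integral_const_mul]
    refine integral_congr_ae (ae_of_all _ fun v => ?_)
    simp only
    by_cases h : v ≤ t
    · rw [indicator_of_mem (mem_Iic.2 h), indicator_of_mem (mem_Ici.2 h), mul_comm]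
      rfl
    · rw [indicator_of_notMem (by simpa using h), indicator_of_notMem (by simpa using h), mul_zero,
        mul_zero]
  · rw [rightMellin, ← integral_div]
    refine setIntegral_congr_fun measurableSet_Ioi fun v hv => ?_
    have hv0 : (v : ℂ) ≠ 0 := by exact_mod_cast (ne_of_gt hv)
    simp only [K]
    rw [integral_const_mul, setIntegral_indicator measurableSet_Ici, hset v hv,
      integral_Ici_eq_integral_Ioi, integral_Ioi_cpow_of_lt hre hv, mul_assoc, mul_div_assoc]
    congr 1
    rw [show w - 1 - s + 1 = -(s - w) by ring, div_neg, neg_div, neg_neg, mul_div_assoc',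
      ← Complex.cpow_add _ _ hv0]
    congr 2
    ring

theorem integral_mul_comp_mul_left_eq (ψ f : HalfLineL2) {r : ℝ} (hr : 0 < r) :
    ∫ t in Ioi (0 : ℝ), ψ t * f (r * t)
      = ((√r : ℝ) : ℂ)⁻¹ * ∫ t in Ioi (0 : ℝ), ψ t * dilation r hr f t := by
  have hne : ((√r : ℝ) : ℂ) ≠ 0 := by exact_mod_cast (Real.sqrt_pos.2 hr).ne'
  rw [← integral_const_mul]
  refine integral_congr_ae ?_
  filter_upwards [dilation_coeFn hr f] with t ht
  rw [ht]
  field_simp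

theorem integrable_mul_comp_mul_left (ψ f : HalfLineL2) {r : ℝ} (hr : 0 < r) :
    Integrable (fun t => ψ t * f (r * t)) (volume.restrict (Ioi (0 : ℝ))) :=
  (Lp.memLp ψ).integrable_mul (memLp_comp_mul_left f hr)

theorem norm_toLp_comp_mul_left_le (f : HalfLineL2) {r : ℝ} (hr : 0 < r) (hr1 : 1 ≤ r) :
    ‖(memLp_comp_mul_left f hr).toLp _‖ ≤ ‖f‖ := by
  rw [Lp.norm_toLp, Lp.norm_def]
  refine ENNReal.toReal_mono (Lp.eLpNorm_ne_top f) ?_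
  have hle : Measure.map (fun t => r * t) (volume.restrict (Ioi (0 : ℝ)))
      ≤ volume.restrict (Ioi (0 : ℝ)) := by
    rw [map_mul_left_restrict_Ioi hr]
    refine Measure.le_iff.2 fun s _ => ?_
    rw [Measure.smul_apply, smul_eq_mul]
    exact mul_le_of_le_one_left zero_le
      (ENNReal.ofReal_le_one.2 (inv_le_one_of_one_le₀ hr1))
  change eLpNorm (f ∘ fun t => r * t) 2 _ ≤ _
  rw [← eLpNorm_map_measure ((Lp.aestronglyMeasurable f).mono_measure hle) (by fun_prop)]
  exact eLpNorm_mono_measure _ hle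

/-- A superposition of contracted copies of `f` has a cosine transform vanishing on `(0, a)`
if `f` has. -/
theorem cosineTransform_superposition_mem {a l : ℝ} (ha : 0 ≤ a) (w c : ℂ) {f h : HalfLineL2}
    (hf : cosineTransform f ∈ vanishingBelow a)
    (hh : ∀ᵐ t ∂volume.restrict (Ioi (0 : ℝ)),
      h t = c * ∫ r in Ioc 1 l, (r : ℂ) ^ (-w) * f (r * t)) :
    cosineTransform h ∈ vanishingBelow a := by
  rw [mem_vanishingBelow_iff_forall]
  intro ψ₀ hψ₀
  rw [pairingCLM_apply, ← integral_cosineTransform_mul]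
  set ψ := cosineTransform ψ₀
  have hfm := Lp.stronglyMeasurable f
  have hψm := Lp.stronglyMeasurable ψ
  have hin : ∀ r : ℝ, 1 < r → ∫ t in Ioi (0 : ℝ), ψ t * f (r * t) = 0 := fun r hr => by
    have hr0 : 0 < r := one_pos.trans hr
    rw [integral_mul_comp_mul_left_eq _ _ hr0, integral_cosineTransform_mul,
      cosineTransform_dilation, ← pairingCLM_apply,
      mem_vanishingBelow_iff_forall.1 (dilation_mem_vanishingBelow (inv_pos.2 hr0) ?_ hf) _ hψ₀,
      mul_zero]
    exact mul_le_of_le_one_left ha (inv_le_one_of_one_le₀ hr.le)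
  set K : ℝ → ℝ → ℂ := fun r t => (r : ℂ) ^ (-w) * (ψ t * f (r * t))
  have hKm : Measurable (Function.uncurry K) := by
    have h1 := hfm.measurable
    have h2 := hψm.measurable
    simp only [Function.uncurry_def, K]
    fun_prop
  have hK : Integrable (Function.uncurry K)
      ((volume.restrict (Ioc 1 l)).prod (volume.restrict (Ioi (0 : ℝ)))) := by
    rw [integrable_prod_iff hKm.aestronglyMeasurable]
    constructor
    · filter_upwards [ae_restrict_mem measurableSet_Ioc] with r hr
      exact (integrable_mul_comp_mul_left ψ f (one_pos.trans hr.1)).const_mul ((r : ℂ) ^ (-w))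
    · refine Integrable.mono' (g := fun _ => max 1 (l ^ (-w.re)) * (‖ψ‖ * ‖f‖))
        (integrableOn_const (by simp))
        hKm.aestronglyMeasurable.norm.integral_prod_right' ?_
      filter_upwards [ae_restrict_mem measurableSet_Ioc] with r hr
      have hr0 : 0 < r := one_pos.trans hr.1
      rw [Real.norm_of_nonneg (integral_nonneg fun _ => norm_nonneg _)]
      simp only [Function.uncurry, K, norm_mul ((r : ℂ) ^ (-w))]
      rw [integral_const_mul, Complex.norm_cpow_eq_rpow_re_of_pos hr0, Complex.neg_re]
      refine mul_le_mul ?_ ?_ (integral_nonneg fun _ => norm_nonneg _) (by positivity)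
      · rcases le_total 0 (-w.re) with h | h
        · exact (Real.rpow_le_rpow hr0.le hr.2 h).trans (le_max_right _ _)
        · exact (Real.rpow_le_one_of_one_le_of_nonpos hr.1.le h).trans (le_max_left _ _)
      · refine le_trans (le_of_eq ?_) ((integral_norm_mul_norm_le ψ
          ((memLp_comp_mul_left f hr0).toLp _)).trans ?_)
        · refine integral_congr_ae ?_
          filter_upwards [(memLp_comp_mul_left f hr0).coeFn_toLp] with t ht
          rw [ht, norm_mul]
        · gcongr
          exact norm_toLp_comp_mul_left_le f hr0 hr.1.le
  have h1 : ∫ t in Ioi (0 : ℝ), ψ t * h t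
      = c * ∫ t in Ioi (0 : ℝ), ∫ r in Ioc 1 l, K r t := by
    rw [← integral_const_mul]
    refine integral_congr_ae ?_
    filter_upwards [hh] with t ht
    rw [ht, mul_left_comm, ← integral_const_mul]
    congr 1
    refine integral_congr_ae (ae_of_all _ fun r => ?_)
    simp only [K]
    ring
  rw [h1, ← integral_integral_swap hK, setIntegral_eq_zero_of_forall_eq_zero, mul_zero]
  intro r hr
  simp only [K]
  rw [integral_const_mul, hin r hr.1, mul_zero]

theorem lintegral_enorm_sq_lt_top (G : HalfLineL2) :
    ∫⁻ t in Ioi (0 : ℝ), ‖G t‖ₑ ^ (2 : ℝ) < ∞ := by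
  simpa using lintegral_rpow_enorm_lt_top_of_eLpNorm_lt_top (by norm_num) (by norm_num)
    (Lp.eLpNorm_lt_top G)

/-- A function in `L²(0, ∞)` which on `(0, a)` is homogeneous of degree `-w`, with `Re w ≥ 1/2`,
vanishes there. -/
theorem mem_vanishingBelow_of_dilation {a : ℝ} {w : ℂ} (hw : 1 / 2 ≤ w.re) {G : HalfLineL2}
    (h : ∀ (l : ℝ) (hl : 0 < l), 1 < l →
      dilation l⁻¹ (inv_pos.2 hl) G - (l : ℂ) ^ (w - 1 / 2) • G ∈ vanishingBelow a) :
    G ∈ vanishingBelow a := by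
  have hGm : Measurable fun t => ‖G t‖ₑ ^ (2 : ℝ) :=
    (Lp.stronglyMeasurable G).measurable.enorm.pow_const _
  have key : ∀ l : ℝ, 1 < l → ∫⁻ t in Ioc 0 a, ‖G t‖ₑ ^ (2 : ℝ)
      ≤ ∫⁻ t in Ioc 0 (l⁻¹ * a), ‖G t‖ₑ ^ (2 : ℝ) := fun l hl => by
    have hl0 : 0 < l := one_pos.trans hl
    have hae : ∀ᵐ t ∂volume.restrict (Ioi (0 : ℝ)), t < a →
        (dilation l⁻¹ (inv_pos.2 hl0) G - (l : ℂ) ^ (w - 1 / 2) • G : HalfLineL2) t = 0 :=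
      h l hl0 hl
    have h1 : ∀ᵐ t ∂volume.restrict (Ioi (0 : ℝ)), (Iio a).indicator (fun t => ‖G t‖ₑ ^ (2 : ℝ)) t
        ≤ ENNReal.ofReal l⁻¹ *
          (Iio (l⁻¹ * a)).indicator (fun t => ‖G t‖ₑ ^ (2 : ℝ)) (l⁻¹ * t) := by
      filter_upwards [hae, dilation_coeFn (inv_pos.2 hl0) G,
        Lp.coeFn_smul ((l : ℂ) ^ (w - 1 / 2)) G,
        Lp.coeFn_sub (dilation l⁻¹ (inv_pos.2 hl0) G) ((l : ℂ) ^ (w - 1 / 2) • G)] with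
        t e1 e2 e3 e4
      by_cases hta : t < a
      · have hta' : l⁻¹ * t < l⁻¹ * a := by gcongr
        rw [indicator_of_mem (mem_Iio.2 hta), indicator_of_mem (mem_Iio.2 hta')]
        have e5 := e1 hta
        rw [e4, Pi.sub_apply, e2, e3, Pi.smul_apply, smul_eq_mul, sub_eq_zero] at e5
        have e6 := congrArg (fun z => ‖z‖) e5
        simp only [norm_mul, Complex.norm_cpow_eq_rpow_re_of_pos hl0, Complex.norm_real,
          Real.norm_of_nonneg (Real.sqrt_nonneg _)] at e6
        have e7 : ‖G t‖ ≤ √l⁻¹ * ‖G (l⁻¹ * t)‖ := by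
          rw [e6]
          refine le_mul_of_one_le_left (norm_nonneg _) (Real.one_le_rpow hl.le ?_)
          simp
          linarith
        rw [ENNReal.rpow_two, ENNReal.rpow_two, ← ofReal_norm, ← ofReal_norm,
          ← ENNReal.ofReal_pow (norm_nonneg _), ← ENNReal.ofReal_pow (norm_nonneg _),
          ← ENNReal.ofReal_mul (by positivity)]
        refine ENNReal.ofReal_le_ofReal ((pow_le_pow_left₀ (norm_nonneg _) e7 2).trans (le_of_eq ?_))
        rw [mul_pow, Real.sq_sqrt (by positivity)]
      · rw [indicator_of_notMem (by simpa using hta)]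
        exact zero_le
    have hset : ∀ x : ℝ, ∫⁻ t in Ioi (0 : ℝ), (Iio x).indicator (fun t => ‖G t‖ₑ ^ (2 : ℝ)) t
        = ∫⁻ t in Ioc 0 x, ‖G t‖ₑ ^ (2 : ℝ) := fun x => by
      rw [setLIntegral_indicator measurableSet_Iio, inter_comm, Ioi_inter_Iio,
        setLIntegral_congr Ioo_ae_eq_Ioc]
    have h2 := lintegral_mono_ae h1
    rw [hset, lintegral_const_mul' _ _ (by simp)] at h2
    refine h2.trans (le_of_eq ?_)
    rw [← lintegral_map (μ := volume.restrict (Ioi (0 : ℝ))) (g := fun t => l⁻¹ * t)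
      (f := (Iio (l⁻¹ * a)).indicator (fun t => ‖G t‖ₑ ^ (2 : ℝ)))
      (hGm.indicator measurableSet_Iio) (by fun_prop), map_mul_left_restrict_Ioi (inv_pos.2 hl0),
      inv_inv, lintegral_smul_measure, hset, smul_eq_mul, ← mul_assoc,
      ← ENNReal.ofReal_mul (by positivity), inv_mul_cancel₀ hl0.ne', ENNReal.ofReal_one, one_mul]
  have hlim : Tendsto (fun l : ℝ => ∫⁻ t in Ioc 0 (l⁻¹ * a), ‖G t‖ₑ ^ (2 : ℝ)
      ∂(volume.restrict (Ioi (0 : ℝ)))) atTop (𝓝 0) := by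
    refine tendsto_setLIntegral_zero (lintegral_enorm_sq_lt_top G).ne ?_
    refine tendsto_of_tendsto_of_tendsto_of_le_of_le tendsto_const_nhds
      (h := fun l : ℝ => ENNReal.ofReal (l⁻¹ * a)) ?_ (fun _ => zero_le) fun l => ?_
    · have : Tendsto (fun l : ℝ => l⁻¹ * a) atTop (𝓝 0) := by
        simpa using (tendsto_inv_atTop_zero (𝕜 := ℝ)).mul_const a
      simpa using ENNReal.tendsto_ofReal this
    · refine (Measure.restrict_apply_le _ _).trans ?_
      simp
  have hzero : ∫⁻ t in Ioc 0 a, ‖G t‖ₑ ^ (2 : ℝ) = 0 := by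
    refine le_antisymm (ge_of_tendsto hlim ?_) (zero_le)
    filter_upwards [eventually_gt_atTop 1] with l hl
    refine (key l hl).trans (le_of_eq ?_)
    rw [Measure.restrict_restrict measurableSet_Ioc, inter_eq_left.2 Ioc_subset_Ioi_self]
  rw [lintegral_eq_zero_iff hGm] at hzero
  change ∀ᵐ t ∂volume.restrict (Ioi (0 : ℝ)), t < a → G t = 0
  rw [Filter.EventuallyEq, ae_restrict_iff' measurableSet_Ioc] at hzero
  rw [ae_restrict_iff' measurableSet_Ioi]
  filter_upwards [hzero] with t ht h1 h2
  simpa using ht ⟨h1, h2.le⟩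

theorem mellinPrimitive_sub {a : ℝ} (ha : 0 < a) {f : HalfLineL2} (hf : f ∈ vanishingBelow a)
    {w : ℂ} (hw : 0 ≤ w.re) {t l : ℝ} (ht : 0 < t) (hl : 1 < l) :
    (t : ℂ) ^ (w - 1) * (mellinPrimitive f w (l * t) - mellinPrimitive f w t)
      = ∫ r in Ioc 1 l, (r : ℂ) ^ (-w) * f (r * t) := by
  have hlt : t ≤ l * t := le_mul_of_one_le_left ht.le hl.le
  have h1 : mellinPrimitive f w (l * t) - mellinPrimitive f w t
      = ∫ v in Ioc t (l * t), f v * (v : ℂ) ^ (-w) := by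
    have hi := integrableOn_Ioc_mul_cpow ha hf hw (l * t)
    rw [mellinPrimitive, mellinPrimitive, sub_eq_iff_eq_add', ← setIntegral_union
      (Set.disjoint_left.2 fun x hx hx' => not_lt.2 hx.2 hx'.1)
      measurableSet_Ioc (hi.mono_set (Ioc_subset_Ioc_right hlt))
      (hi.mono_set (Ioc_subset_Ioc_left ht.le)), Ioc_union_Ioc_eq_Ioc ht.le hlt]
  have h2 := intervalIntegral.integral_comp_mul_right (a := 1) (b := l)
    (fun v => f v * (v : ℂ) ^ (-w)) ht.ne'
  rw [one_mul, intervalIntegral.integral_of_le hl.le, intervalIntegral.integral_of_le hlt,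
    ← h1] at h2
  have ht0 : (t : ℂ) ≠ 0 := by exact_mod_cast ht.ne'
  have h3 : mellinPrimitive f w (l * t) - mellinPrimitive f w t
      = (t : ℂ) * ∫ r in Ioc 1 l, f (r * t) * ((r * t : ℝ) : ℂ) ^ (-w) := by
    rw [h2, Complex.real_smul, Complex.ofReal_inv, mul_inv_cancel_left₀ ht0]
  rw [h3, ← mul_assoc, ← integral_const_mul]
  refine setIntegral_congr_fun measurableSet_Ioc fun r hr => ?_
  have hr0 : 0 < r := one_pos.trans hr.1
  have h4 : ((r * t : ℝ) : ℂ) ^ (-w) = (r : ℂ) ^ (-w) * (t : ℂ) ^ (-w) := by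
    rw [Complex.ofReal_mul, Complex.mul_cpow_ofReal_nonneg hr0.le ht.le]
  have h5 : (t : ℂ) ^ (w - 1) * t * (t : ℂ) ^ (-w) = 1 := by
    rw [Complex.cpow_sub _ _ ht0, Complex.cpow_neg, Complex.cpow_one, div_mul_cancel₀ _ ht0,
      mul_inv_cancel₀]
    simp [Complex.cpow_eq_zero_iff, ht0]
  rw [h4]
  linear_combination f (r * t) * (r : ℂ) ^ (-w) * h5

/-- Division by `s - w` of the Mellin transforms of the elements of a Sonine space, for `w` in
the right half of the critical strip. -/
theorem exists_thetaMellin_div_of_half_le {a : ℝ} (ha : 0 < a) {f : HalfLineL2}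
    (hf : f ∈ sonineSpace a) {w : ℂ} (hw : 1 / 2 ≤ w.re) (h0 : thetaMellin f w = 0) :
    ∃ g ∈ sonineSpace a, ∀ s, thetaMellin f s = (s - w) * thetaMellin g s := by
  have hw0 : 0 < w.re := by linarith
  have hfv := mem_sonineSpace.1 hf
  have hmem := memLp_mellinDivision ha hf hw0 h0
  set g : HalfLineL2 := hmem.toLp _
  have hgc : ∀ᵐ t ∂volume.restrict (Ioi (0 : ℝ)), g t = (t : ℂ) ^ (w - 1) * mellinPrimitive f w t :=
    hmem.coeFn_toLp
  have hgv : g ∈ vanishingBelow a := by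
    change ∀ᵐ t ∂volume.restrict (Ioi (0 : ℝ)), t < a → g t = 0
    filter_upwards [hgc] with t ht hta
    rw [ht, mellinPrimitive_eq_zero hfv.1 w hta, mul_zero]
  have hG : cosineTransform g ∈ vanishingBelow a := by
    refine mem_vanishingBelow_of_dilation hw fun l hl hl1 => ?_
    rw [← cosineTransform_dilation hl, ← map_smul, ← map_sub]
    refine cosineTransform_superposition_mem ha.le w ((l : ℂ) ^ (w - 1 / 2)) (l := l) hfv.2 ?_
    filter_upwards [hgc, ae_comp_mul_left hl hgc, dilation_coeFn hl g,
      Lp.coeFn_smul ((l : ℂ) ^ (w - 1 / 2)) g,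
      Lp.coeFn_sub (dilation l hl g) ((l : ℂ) ^ (w - 1 / 2) • g),
      ae_restrict_mem measurableSet_Ioi] with t e1 e2 e3 e4 e5 ht
    rw [mem_Ioi] at ht
    have hl0 : (l : ℂ) ≠ 0 := by exact_mod_cast hl.ne'
    have h1 : (√l : ℂ) * ((l * t : ℝ) : ℂ) ^ (w - 1)
        = (l : ℂ) ^ (w - 1 / 2) * (t : ℂ) ^ (w - 1) := by
      rw [Complex.ofReal_mul, Complex.mul_cpow_ofReal_nonneg hl.le ht.le, Real.sqrt_eq_rpow,
        Complex.ofReal_cpow hl.le, ← mul_assoc, ← Complex.cpow_add _ _ hl0]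
      congr 2
      push_cast
      ring
    rw [e5, Pi.sub_apply, e3, e4, Pi.smul_apply, smul_eq_mul, e1, e2,
      ← mellinPrimitive_sub ha hfv.1 hw0.le ht hl1]
    linear_combination mellinPrimitive f w (l * t) * h1
  have hgs : g ∈ sonineSpace a := mem_sonineSpace.2 ⟨hgv, hG⟩
  refine ⟨g, hgs, fun s => ?_⟩
  refine congrFun (eq_of_eqOn_halfPlane (differentiable_thetaMellin ha hf)
    (G := fun s => (s - w) * thetaMellin g s)
    ((differentiable_id.sub_const w).mul (differentiable_thetaMellin ha hgs)) w.re fun s hs => ?_) s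
  have hs2 : 1 / 2 < s.re := hw.trans_lt hs
  have hne : s - w ≠ 0 := fun h => by
    rw [sub_eq_zero] at h
    rw [h] at hs
    exact lt_irrefl _ hs
  have hr : rightMellin g s = rightMellin f s / (s - w) := by
    rw [← rightMellin_mellinDivision ha hfv.1 hs2 hs]
    refine integral_congr_ae ?_
    filter_upwards [hgc] with t ht
    rw [ht]
  simp only [thetaMellin]
  rw [mellin_theta_eq ha hfv.1 hs2, mellin_theta_eq ha hgv hs2, hr]
  field_simp

/-- If `M(f)(w) = 0` then `M(f)(s) / (s - w)` belongs to the space of completed Mellin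
transforms. -/
theorem exists_thetaMellin_div {a : ℝ} (ha : 0 < a) {f : HalfLineL2}
    (hf : f ∈ sonineSpace a) {w : ℂ} (h0 : thetaMellin f w = 0) :
    ∃ g ∈ sonineSpace a, ∀ s, thetaMellin f s = (s - w) * thetaMellin g s := by
  rcases le_total (1 / 2) w.re with hw | hw
  · exact exists_thetaMellin_div_of_half_le ha hf hw h0
  · obtain ⟨g, hg, h⟩ := exists_thetaMellin_div_of_half_le ha (cosineTransform_mem_sonineSpace hf)
      (w := 1 - w) (by simp; linarith) (by rw [thetaMellin_cosineTransform, sub_sub_cancel, h0])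
    refine ⟨(-1 : ℂ) • cosineTransform g,
      Submodule.smul_mem _ _ (cosineTransform_mem_sonineSpace hg), fun s => ?_⟩
    have := h (1 - s)
    rw [thetaMellin_cosineTransform, sub_sub_cancel] at this
    rw [this, thetaMellin_smul, thetaMellin_cosineTransform]
    ring

/-- Multiplication by an entire function with a simple zero at `w`, at the expense of shrinking
the gap of the Sonine space. -/
theorem exists_thetaMellin_mul {a b : ℝ} (ha : 0 < a) (hab : a < b) {f : HalfLineL2}
    (hf : f ∈ sonineSpace b) (w : ℂ) :
    ∃ g ∈ sonineSpace a, ∃ q : ℂ → ℂ, Differentiable ℂ q ∧ q w = 0 ∧ deriv q w ≠ 0 ∧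
      ∀ s, thetaMellin g s = q s * thetaMellin f s := by
  have hl : 0 < b / a := div_pos (ha.trans hab) ha
  have hl1 : 1 < b / a := (one_lt_div ha).2 hab
  have hfa := sonineSpace_anti hab.le hf
  have hd : dilation (b / a) hl f ∈ sonineSpace a :=
    dilation_mem_sonineSpace hl (div_mul_cancel₀ b ha.ne').le
      (hab.le.trans (le_mul_of_one_le_left (ha.trans hab).le hl1.le)) hf
  set l := b / a
  have hl0 : (l : ℂ) ≠ 0 := by exact_mod_cast hl.ne'
  have hder : ∀ s : ℂ, HasDerivAt (fun s : ℂ => (l : ℂ) ^ (s - 1 / 2) - (l : ℂ) ^ (w - 1 / 2))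
      ((l : ℂ) ^ (s - 1 / 2) * Complex.log l) s := fun s => by
    have h1 : HasDerivAt (fun s : ℂ => s - 1 / 2) 1 s := (hasDerivAt_id s).sub_const _
    simpa using (h1.const_cpow (Or.inl hl0)).sub_const ((l : ℂ) ^ (w - 1 / 2))
  refine ⟨dilation l hl f + (-(l : ℂ) ^ (w - 1 / 2)) • f,
    Submodule.add_mem _ hd (Submodule.smul_mem _ _ hfa),
    fun s => (l : ℂ) ^ (s - 1 / 2) - (l : ℂ) ^ (w - 1 / 2),
    fun s => (hder s).differentiableAt, sub_self _, ?_, fun s => ?_⟩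
  · rw [(hder w).deriv, ← Complex.ofReal_log hl.le]
    refine mul_ne_zero (by simp [Complex.cpow_eq_zero_iff, hl0]) ?_
    exact_mod_cast (Real.log_pos hl1).ne'
  · rw [thetaMellin_add ha hd (Submodule.smul_mem _ _ hfa), thetaMellin_dilation, thetaMellin_smul]
    ring

theorem isCompleteSystem_iff {ι E : Type*} [NormedAddCommGroup E] [InnerProductSpace ℂ E]
    [CompleteSpace E] (u : ι → E) :
    IsCompleteSystem u ↔ ∀ h : E, (∀ i, inner ℂ h (u i) = 0) → h = 0 := by
  rw [IsCompleteSystem, Submodule.dense_iff_topologicalClosure_eq_top,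
    Submodule.topologicalClosure_eq_top_iff, Submodule.eq_bot_iff]
  refine forall_congr' fun h => imp_congr_left ?_
  rw [Submodule.mem_orthogonal']
  constructor
  · exact fun H i => H _ (Submodule.subset_span (mem_range_self i))
  · intro H v hv
    induction hv using Submodule.span_induction with
    | mem x hx => obtain ⟨i, rfl⟩ := hx; exact H i
    | zero => exact inner_zero_right _
    | add x y _ _ hx hy => rw [inner_add_right, hx, hy, add_zero]
    | smul c x _ hx => rw [inner_smul_right, hx, mul_zero]

theorem isMinimalSystem_iff {ι E : Type*} [NormedAddCommGroup E] [InnerProductSpace ℂ E]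
    [CompleteSpace E] (u : ι → E) :
    IsMinimalSystem u ↔
      ∀ i, ∃ h : E, (∀ j, j ≠ i → inner ℂ h (u j) = 0) ∧ inner ℂ h (u i) ≠ 0 := by
  refine forall_congr' fun i => ?_
  set W := (Submodule.span ℂ (u '' {j | j ≠ i})).topologicalClosure
  have hW : closure (Submodule.span ℂ (u '' {j | j ≠ i}) : Set E) = W :=
    (Submodule.topologicalClosure_coe _).symm
  have hWc : IsClosed (W : Set E) := Submodule.isClosed_topologicalClosure _
  have : CompleteSpace W := hWc.completeSpace_coe
  rw [hW, SetLike.mem_coe, ← Submodule.orthogonal_orthogonal W, Submodule.mem_orthogonal]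
  push Not
  refine exists_congr fun h => and_congr_left fun _ => ?_
  rw [Submodule.orthogonal_closure, Submodule.mem_orthogonal']
  constructor
  · exact fun H j hj => H _ (Submodule.subset_span (mem_image_of_mem u hj))
  · intro H v hv
    induction hv using Submodule.span_induction with
    | mem x hx => obtain ⟨j, hj, rfl⟩ := hx; exact H j hj
    | zero => exact inner_zero_right _
    | add x y _ _ hx hy => rw [inner_add_right, hx, hy, add_zero]
    | smul c x _ hx => rw [inner_smul_right, hx, mul_zero]

instance completeSpace_sonineSpace (a : ℝ) : CompleteSpace (sonineSpace a) :=
  (isClosed_sonineSpace a).completeSpace_coe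

/-- The functional `f ↦ M(f)^{(k)}(w)` on a Sonine space. -/
def evaluation {a : ℝ} (ha : 0 < a) (w : ℂ) (k : ℕ) : sonineSpace a →ₗ[ℂ] ℂ where
  toFun f := iteratedDeriv k (thetaMellin (f : HalfLineL2)) w
  map_add' f g := by
    have h : thetaMellin ((f + g : sonineSpace a) : HalfLineL2)
        = thetaMellin (f : HalfLineL2) + thetaMellin (g : HalfLineL2) :=
      funext fun s => thetaMellin_add ha f.2 g.2 s
    rw [h]
    exact iteratedDeriv_add (differentiable_thetaMellin ha f.2).contDiff.contDiffAt
      (differentiable_thetaMellin ha g.2).contDiff.contDiffAt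
  map_smul' c f := by
    have h : thetaMellin ((c • f : sonineSpace a) : HalfLineL2)
        = fun s => c * thetaMellin (f : HalfLineL2) s :=
      funext fun s => thetaMellin_smul c f s
    rw [h, iteratedDeriv_const_mul_field]
    rfl

theorem exists_norm_evaluation_le {a : ℝ} (ha : 0 < a) (w : ℂ) (k : ℕ) :
    ∃ C : ℝ, ∀ f : sonineSpace a, ‖evaluation ha w k f‖ ≤ C * ‖f‖ := by
  obtain ⟨C, hC0, hC⟩ := exists_norm_mellin_theta_le ha ((|w.re| + 1) / 2)
  refine ⟨k.factorial * C, fun f => ?_⟩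
  have h := Complex.norm_iteratedDeriv_le_of_forall_mem_sphere_norm_le k (R := 1)
    (C := C * ‖(f : HalfLineL2)‖) (c := w) (f := thetaMellin (f : HalfLineL2)) one_pos
    (differentiable_thetaMellin ha f.2).diffContOnCl fun z hz => ?_
  · refine h.trans (le_of_eq ?_)
    rw [one_pow, div_one, mul_assoc]; rfl
  · refine hC f f.2 _ ?_
    rw [Complex.div_ofNat_re, abs_div, abs_two]
    gcongr
    have h1 : |(z - w).re| ≤ 1 := (Complex.abs_re_le_norm _).trans
      (le_of_eq (by simpa [dist_eq_norm] using hz))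
    calc |z.re| = |w.re + (z - w).re| := by simp
      _ ≤ |w.re| + |(z - w).re| := abs_add_le _ _
      _ ≤ _ := by gcongr

theorem isEvaluator_evaluator {a : ℝ} (ha : 0 < a) (w : ℂ) (k : ℕ) :
    IsEvaluator a w k (evaluator a w k) := by
  have hex : ∃ Z, IsEvaluator a w k Z := by
    obtain ⟨C, hC⟩ := exists_norm_evaluation_le ha w k
    set R := (InnerProductSpace.toDual ℂ (sonineSpace a)).symm ((evaluation ha w k).mkContinuous C hC)
    refine ⟨⟨star (R : HalfLineL2), star_mem_sonineSpace R.2⟩, fun f => ?_⟩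
    have h : inner ℂ R f = evaluation ha w k f := by
      rw [InnerProductSpace.toDual_symm_apply]; rfl
    rw [completedMellin_eq ha f.2]
    refine Eq.trans ?_ h
    rw [Submodule.coe_inner, inner_eq_integral_star_mul]
    simp_rw [mul_comm]
  rw [evaluator, dif_pos hex]
  exact hex.choose_spec

theorem inner_evaluator {a : ℝ} (ha : 0 < a) (w : ℂ) (k : ℕ) (h : sonineSpace a) :
    inner ℂ h (evaluator a w k) = iteratedDeriv k (thetaMellin (star (h : HalfLineL2))) w := by
  have hs := star_mem_sonineSpace h.2
  have := isEvaluator_evaluator ha w k ⟨_, hs⟩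
  rw [completedMellin_eq ha hs] at this
  rw [← this, Submodule.coe_inner, inner_eq_integral_star_mul]

/-- Completeness of a system of evaluators, as a uniqueness property. -/
theorem isCompleteSystem_evaluatorSystem_iff {a : ℝ} (ha : 0 < a) (I : Set (ℂ × ℕ)) :
    IsCompleteSystem (evaluatorSystem a I) ↔
      ∀ f ∈ sonineSpace a, (∀ p ∈ I, iteratedDeriv p.2 (thetaMellin f) p.1 = 0) → f = 0 := by
  rw [isCompleteSystem_iff]
  constructor
  · intro H f hf h0
    have := H ⟨star f, star_mem_sonineSpace hf⟩ fun p => by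
      rw [evaluatorSystem, inner_evaluator ha]
      simpa using h0 p p.2
    have h1 : star f = 0 := congrArg Subtype.val this
    have h2 : star (star f) = star (0 : HalfLineL2) := congrArg star h1
    rw [star_star] at h2
    rw [h2]
    ext1
    filter_upwards [Lp.coeFn_star (0 : HalfLineL2),
      Lp.coeFn_zero ℂ 2 (volume.restrict (Ioi (0 : ℝ)))] with t e1 e2
    rw [e1, Pi.star_apply, e2]
    exact star_zero ℂ
  · intro H h h0
    have h1 := H _ (star_mem_sonineSpace h.2) fun p hp => by
      have := h0 ⟨p, hp⟩
      rwa [evaluatorSystem, inner_evaluator ha] at this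
    refine inner_self_eq_zero (𝕜 := ℂ).1 ?_
    rw [Submodule.coe_inner, inner_eq_integral_star_mul, h1]
    refine integral_eq_zero_of_ae ?_
    filter_upwards [Lp.coeFn_zero ℂ 2 (volume.restrict (Ioi (0 : ℝ)))] with t e2
    rw [e2]
    exact zero_mul _

/-- Minimality of a system of evaluators, as an interpolation property. -/
theorem isMinimalSystem_evaluatorSystem_iff {a : ℝ} (ha : 0 < a) (I : Set (ℂ × ℕ)) :
    IsMinimalSystem (evaluatorSystem a I) ↔
      ∀ p ∈ I, ∃ f ∈ sonineSpace a,
        (∀ r ∈ I, r ≠ p → iteratedDeriv r.2 (thetaMellin f) r.1 = 0) ∧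
          iteratedDeriv p.2 (thetaMellin f) p.1 ≠ 0 := by
  rw [isMinimalSystem_iff]
  constructor
  · intro H p hp
    obtain ⟨h, h1, h2⟩ := H ⟨p, hp⟩
    refine ⟨_, star_mem_sonineSpace h.2, fun r hr hrp => ?_, ?_⟩
    · have := h1 ⟨r, hr⟩ fun e => hrp (congrArg Subtype.val e)
      rwa [evaluatorSystem, inner_evaluator ha] at this
    · rwa [evaluatorSystem, inner_evaluator ha] at h2
  · intro H p
    obtain ⟨f, hf, h1, h2⟩ := H p p.2
    refine ⟨⟨star f, star_mem_sonineSpace hf⟩, fun r hr => ?_, ?_⟩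
    · rw [evaluatorSystem, inner_evaluator ha]
      simpa using h1 r r.2 fun e => hr (Subtype.ext e)
    · rw [evaluatorSystem, inner_evaluator ha]
      simpa using h2

/-- The order of vanishing at `w` of the completed Mellin transform of `f`. -/
def zeroOrder (f : HalfLineL2) (w : ℂ) : ℕ := analyticOrderNatAt (thetaMellin f) w

theorem analyticOrderAt_thetaMellin_ne_top {a : ℝ} (ha : 0 < a) {f : HalfLineL2}
    (hf : f ∈ sonineSpace a) (hf0 : f ≠ 0) (w : ℂ) : analyticOrderAt (thetaMellin f) w ≠ ⊤ := by
  intro h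
  refine hf0 (eq_zero_of_thetaMellin_eq_zero ha hf fun s => ?_)
  exact congrFun (AnalyticOnNhd.eq_of_eventuallyEq (g := fun _ => 0)
    (fun z _ => (differentiable_thetaMellin ha hf).analyticAt z)
    (fun _ _ => analyticAt_const) (analyticOrderAt_eq_top.1 h)) s

theorem coe_zeroOrder {a : ℝ} (ha : 0 < a) {f : HalfLineL2}
    (hf : f ∈ sonineSpace a) (hf0 : f ≠ 0) (w : ℂ) :
    (zeroOrder f w : ℕ∞) = analyticOrderAt (thetaMellin f) w :=
  Nat.cast_analyticOrderNatAt (analyticOrderAt_thetaMellin_ne_top ha hf hf0 w)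

theorem le_zeroOrder_iff {a : ℝ} (ha : 0 < a) {f : HalfLineL2}
    (hf : f ∈ sonineSpace a) (hf0 : f ≠ 0) {w : ℂ} {n : ℕ} :
    n ≤ zeroOrder f w ↔ ∀ k < n, iteratedDeriv k (thetaMellin f) w = 0 := by
  rw [← natCast_le_analyticOrderAt_iff_iteratedDeriv_eq_zero
    ((differentiable_thetaMellin ha hf).analyticAt w), ← coe_zeroOrder ha hf hf0, Nat.cast_le]

theorem iteratedDeriv_zeroOrder_ne_zero {a : ℝ} (ha : 0 < a) {f : HalfLineL2}
    (hf : f ∈ sonineSpace a) (hf0 : f ≠ 0) (w : ℂ) :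
    iteratedDeriv (zeroOrder f w) (thetaMellin f) w ≠ 0 := by
  intro h
  refine (Nat.lt_irrefl _ ((le_zeroOrder_iff ha hf hf0).2 fun k hk => ?_ :
    zeroOrder f w + 1 ≤ zeroOrder f w))
  rcases (Nat.lt_succ_iff.1 hk).lt_or_eq with hk | rfl
  · exact (le_zeroOrder_iff ha hf hf0).1 le_rfl k hk
  · exact h

/-- Dividing by a linear factor lowers the order of vanishing by one at one point only. -/
theorem exists_zeroOrder_sub_one {a : ℝ} (ha : 0 < a) {f : HalfLineL2}
    (hf : f ∈ sonineSpace a) (hf0 : f ≠ 0) {w : ℂ} (hw : 0 < zeroOrder f w) :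
    ∃ g ∈ sonineSpace a, g ≠ 0 ∧ zeroOrder f w = zeroOrder g w + 1 ∧
      ∀ z ≠ w, zeroOrder g z = zeroOrder f z := by
  have h0 : thetaMellin f w = 0 := by
    simpa using (le_zeroOrder_iff ha hf hf0).1 (Nat.succ_le_of_lt hw) 0 one_pos
  obtain ⟨g, hg, hfg⟩ := exists_thetaMellin_div ha hf h0
  have hg0 : g ≠ 0 := by
    rintro rfl
    refine hf0 (eq_zero_of_thetaMellin_eq_zero ha hf fun s => ?_)
    have := thetaMellin_smul 0 (0 : HalfLineL2) s
    rw [hfg, ← zero_smul ℂ (0 : HalfLineL2), this]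
    ring
  have hq : ∀ z, AnalyticAt ℂ (fun s : ℂ => s - w) z := fun z => by fun_prop
  have hmul : ∀ z, (zeroOrder f z : ℕ∞)
      = analyticOrderAt (fun s : ℂ => s - w) z + zeroOrder g z := fun z => by
    rw [coe_zeroOrder ha hf hf0, coe_zeroOrder ha hg hg0, funext hfg]
    exact analyticOrderAt_mul (hq z) ((differentiable_thetaMellin ha hg).analyticAt z)
  refine ⟨g, hg, hg0, ?_, fun z hz => ?_⟩
  · have := hmul w
    rw [(hq w).analyticOrderAt_eq_one_of_zero_deriv_ne_zero (sub_self w) (by simp), add_comm] at this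
    exact_mod_cast this
  · have := hmul z
    rw [(hq z).analyticOrderAt_eq_zero.2 (sub_ne_zero.2 hz), zero_add] at this
    exact_mod_cast this.symm

theorem exists_zeroOrder_eq {a : ℝ} (ha : 0 < a) {f : HalfLineL2}
    (hf : f ∈ sonineSpace a) (hf0 : f ≠ 0) {w : ℂ} {k : ℕ} (hk : k ≤ zeroOrder f w) :
    ∃ g ∈ sonineSpace a, g ≠ 0 ∧ zeroOrder g w = k ∧
      ∀ z ≠ w, zeroOrder g z = zeroOrder f z := by
  induction hn : zeroOrder f w - k generalizing f with
  | zero => exact ⟨f, hf, hf0, by omega, fun _ _ => rfl⟩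
  | succ n ih =>
    obtain ⟨g, hg, hg0, h1, h2⟩ := exists_zeroOrder_sub_one ha hf hf0 (w := w) (by omega)
    obtain ⟨e, he, he0, h3, h4⟩ := ih hg hg0 (by omega) (by omega)
    exact ⟨e, he, he0, h3, fun z hz => (h4 z hz).trans (h2 z hz)⟩

/-- A zero can be added at the cost of shrinking the parameter of the Sonine space. -/
theorem exists_zeroOrder_add_one {a b : ℝ} (ha : 0 < a) (hab : a < b) {f : HalfLineL2}
    (hf : f ∈ sonineSpace b) (hf0 : f ≠ 0) (w : ℂ) :
    ∃ g ∈ sonineSpace a, g ≠ 0 ∧ zeroOrder f w + 1 ≤ zeroOrder g w ∧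
      ∀ z, zeroOrder f z ≤ zeroOrder g z := by
  have hb := ha.trans hab
  obtain ⟨g, hg, q, hq, hqw, hdq, hgf⟩ := exists_thetaMellin_mul ha hab hf w
  have hord : ∀ z, analyticOrderAt (thetaMellin g) z
      = analyticOrderAt q z + zeroOrder f z := fun z => by
    rw [coe_zeroOrder hb hf hf0, funext hgf]
    exact analyticOrderAt_mul (hq.analyticAt z) ((differentiable_thetaMellin hb hf).analyticAt z)
  have hw := hord w
  rw [(hq.analyticAt w).analyticOrderAt_eq_one_of_zero_deriv_ne_zero hqw hdq] at hw
  have hg0 : g ≠ 0 := by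
    rintro rfl
    have h0 : thetaMellin (0 : HalfLineL2) = fun _ => 0 := funext fun s => by
      rw [← zero_smul ℂ (0 : HalfLineL2), thetaMellin_smul, zero_mul]
    rw [h0, analyticOrderAt_eq_top.2 (Eventually.of_forall fun _ => rfl)] at hw
    exact ENat.natCast_ne_top (1 + zeroOrder f w) (by rw [hw]; push_cast; rfl)
  refine ⟨g, hg, hg0, ?_, fun z => ?_⟩
  · rw [← coe_zeroOrder ha hg hg0, add_comm] at hw
    exact_mod_cast hw.ge
  · have := hord z
    rw [← coe_zeroOrder ha hg hg0] at this
    exact_mod_cast this ▸ le_add_self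

theorem exists_zeroOrder_add {a b : ℝ} (ha : 0 < a) (hab : a < b) {f : HalfLineL2}
    (hf : f ∈ sonineSpace b) (hf0 : f ≠ 0) (w : ℂ) (n : ℕ) :
    ∃ g ∈ sonineSpace a, g ≠ 0 ∧ n ≤ zeroOrder g w ∧ ∀ z, zeroOrder f z ≤ zeroOrder g z := by
  induction n generalizing a with
  | zero => exact ⟨f, sonineSpace_anti hab.le hf, hf0, Nat.zero_le _, fun _ => le_rfl⟩
  | succ n ih =>
    obtain ⟨c, hac, hcb⟩ := exists_between hab
    obtain ⟨g, hg, hg0, h1, h2⟩ := ih (ha.trans hac) hcb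
    obtain ⟨e, he, he0, h3, h4⟩ := exists_zeroOrder_add_one ha hac hg hg0 w
    exact ⟨e, he, he0, by omega, fun z => (h2 z).trans (h4 z)⟩

theorem exists_lt_zeroOrder_of_finite {a b : ℝ} (ha : 0 < a) (hab : a < b) {f : HalfLineL2}
    (hf : f ∈ sonineSpace b) (hf0 : f ≠ 0) {S : Set (ℂ × ℕ)} (hS : S.Finite) :
    ∃ g ∈ sonineSpace a, g ≠ 0 ∧ (∀ p ∈ S, p.2 < zeroOrder g p.1) ∧
      ∀ z, zeroOrder f z ≤ zeroOrder g z := by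
  induction S, hS using Set.Finite.induction_on generalizing a with
  | empty => exact ⟨f, sonineSpace_anti hab.le hf, hf0, by simp, fun _ => le_rfl⟩
  | @insert p S _ _ ih =>
    obtain ⟨c, hac, hcb⟩ := exists_between hab
    obtain ⟨g, hg, hg0, h1, h2⟩ := ih (ha.trans hac) hcb
    obtain ⟨e, he, he0, h3, h4⟩ := exists_zeroOrder_add ha hac hg hg0 p.1 (p.2 + 1)
    refine ⟨e, he, he0, ?_, fun z => (h2 z).trans (h4 z)⟩
    rintro r (rfl | hr)
    · exact h3
    · exact (h1 r hr).trans_le (h4 _)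

/-- Triangular systems can be solved: if `ℓ i (g j)` is triangular with non-zero diagonal, some
vector is annihilated by all functionals but one. -/
theorem exists_biorthogonal_of_triangular {𝕜 V : Type*} [Field 𝕜] [AddCommGroup V] [Module 𝕜 V] (ℓ : ℕ → V →ₗ[𝕜] 𝕜)
    (g : ℕ → V) {n : ℕ} (h0 : ∀ k < n, ∀ j < k, ℓ j (g k) = 0) (h1 : ∀ k < n, ℓ k (g k) ≠ 0)
    {k : ℕ} (hk : k < n) : ∃ e, ℓ k e ≠ 0 ∧ ∀ j < n, j ≠ k → ℓ j e = 0 := by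
  suffices H : ∀ μ, k + 1 ≤ μ → μ ≤ n → ∃ e, ℓ k e ≠ 0 ∧ ∀ j < μ, j ≠ k → ℓ j e = 0 from
    H n hk le_rfl
  intro μ hμ
  induction μ, hμ using Nat.le_induction with
  | base => exact fun _ => ⟨g k, h1 k hk, fun j hj hjk => h0 k hk j (by omega)⟩
  | succ μ hμ ih =>
    intro hμn
    obtain ⟨e, he1, he2⟩ := ih (by omega)
    refine ⟨e - (ℓ μ e / ℓ μ (g μ)) • g μ, ?_, fun j hj hjk => ?_⟩
    · rwa [map_sub, map_smul, h0 μ (by omega) k (by omega), smul_zero, sub_zero]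
    · rw [map_sub, map_smul, smul_eq_mul]
      rcases (Nat.lt_succ_iff.1 hj).lt_or_eq with hj | rfl
      · rw [h0 μ (by omega) j hj, he2 j hj hjk, mul_zero, sub_zero]
      · rw [div_mul_cancel₀ _ (h1 j (by omega)), sub_self]

theorem isMinimalSystem_of_lt_zeroOrder {a : ℝ} (ha : 0 < a) {f : HalfLineL2}
    (hf : f ∈ sonineSpace a) (hf0 : f ≠ 0) {I : Set (ℂ × ℕ)} (hI : ∀ p ∈ I, p.2 < zeroOrder f p.1) :
    IsMinimalSystem (evaluatorSystem a I) := by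
  rw [isMinimalSystem_evaluatorSystem_iff ha]
  rintro ⟨w, k⟩ hp
  let V : Submodule ℂ (sonineSpace a) :=
    ⨅ (r : ℂ × ℕ) (_ : r ∈ I ∧ r.1 ≠ w), LinearMap.ker (evaluation ha r.1 r.2)
  have hV : ∀ g : sonineSpace a, g ∈ V ↔ ∀ r ∈ I, r.1 ≠ w →
      iteratedDeriv r.2 (thetaMellin (g : HalfLineL2)) r.1 = 0 := fun g => by
    simp only [V, Submodule.mem_iInf, LinearMap.mem_ker, and_imp]
    rfl
  have hex : ∀ j : ℕ, ∃ g : V, j < zeroOrder f w →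
      (∀ i < j, evaluation ha w i g = 0) ∧ evaluation ha w j g ≠ 0 := fun j => by
    by_cases hj : j < zeroOrder f w
    · obtain ⟨g, hg, hg0, h1, h2⟩ := exists_zeroOrder_eq ha hf hf0 hj.le
      refine ⟨⟨⟨g, hg⟩, (hV _).2 fun r hr hrw => ?_⟩, fun _ => ⟨?_, ?_⟩⟩
      · exact (le_zeroOrder_iff ha hg hg0).1 le_rfl _ ((hI r hr).trans_eq (h2 _ hrw).symm)
      · exact (le_zeroOrder_iff ha hg hg0).1 h1.ge
      · exact h1 ▸ iteratedDeriv_zeroOrder_ne_zero ha hg hg0 w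
    · exact ⟨0, fun h => absurd h hj⟩
  choose g hg using hex
  obtain ⟨e, he1, he2⟩ := exists_biorthogonal_of_triangular (fun j => (evaluation ha w j).comp V.subtype) g
    (fun j hj => (hg j hj).1) (fun j hj => (hg j hj).2) (hI _ hp)
  refine ⟨e, e.1.2, fun r hr hrp => ?_, he1⟩
  obtain ⟨z, j⟩ := r
  by_cases hz : z = w
  · subst hz
    exact he2 j (hI _ hr) fun h => hrp (by rw [h])
  · exact (hV _).1 e.2 _ hr hz

theorem not_isCompleteSystem_of_lt_zeroOrder {a : ℝ} (ha : 0 < a) {f : HalfLineL2}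
    (hf : f ∈ sonineSpace a) (hf0 : f ≠ 0) {I : Set (ℂ × ℕ)} (hI : ∀ p ∈ I, p.2 < zeroOrder f p.1) :
    ¬ IsCompleteSystem (evaluatorSystem a I) := by
  rw [isCompleteSystem_evaluatorSystem_iff ha]
  exact fun H => hf0 (H f hf fun p hp => (le_zeroOrder_iff ha hf hf0).1 le_rfl _ (hI p hp))

theorem exists_le_zeroOrder_of_not_isCompleteSystem {a : ℝ} (ha : 0 < a) {m : ℂ → ℕ}
    (h : ¬ IsCompleteSystem (evaluatorSystem a (multisetIndices m))) :
    ∃ f ∈ sonineSpace a, f ≠ 0 ∧ ∀ w, m w ≤ zeroOrder f w := by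
  rw [isCompleteSystem_evaluatorSystem_iff ha] at h
  push Not at h
  obtain ⟨f, hf, h1, h2⟩ := h
  exact ⟨f, hf, h2, fun w => (le_zeroOrder_iff ha hf h2).2 fun k hk => h1 (w, k) hk⟩

theorem exists_le_zeroOrder_of_isMinimalSystem {a b : ℝ} (ha : 0 < a) (hab : a < b) {m : ℂ → ℕ}
    (hne : (Function.support m).Nonempty)
    (h : IsMinimalSystem (evaluatorSystem b (multisetIndices m))) :
    ∃ f ∈ sonineSpace a, f ≠ 0 ∧ ∀ w, m w ≤ zeroOrder f w := by
  have hb := ha.trans hab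
  obtain ⟨w, hw⟩ := hne
  have hw : 0 < m w := Nat.pos_of_ne_zero hw
  have hp : (w, m w - 1) ∈ multisetIndices m := Nat.sub_lt hw one_pos
  obtain ⟨f, hf, h1, h2⟩ := (isMinimalSystem_evaluatorSystem_iff hb _).1 h _ hp
  have hf0 : f ≠ 0 := by
    rintro rfl
    exact h2 ((evaluation hb w (m w - 1)).map_zero)
  obtain ⟨g, hg, hg0, h3, h4⟩ := exists_zeroOrder_add_one ha hab hf hf0 w
  refine ⟨g, hg, hg0, fun z => ?_⟩
  by_cases hz : z = w
  · subst hz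
    have : m z - 1 ≤ zeroOrder f z := (le_zeroOrder_iff hb hf hf0).2 fun k hk =>
      h1 (z, k) (show k < m z by omega) fun e => hk.ne (congrArg Prod.snd e)
    omega
  · exact ((le_zeroOrder_iff hb hf hf0).2 fun k hk =>
      h1 (z, k) hk fun e => hz (congrArg Prod.fst e)).trans (h4 z)

end

theorem mainTheorem6 (m : ℂ → ℕ) (hne : (Function.support m).Nonempty)
    (hcount : (Function.support m).Countable) :
    minimalityIndex m = completenessIndex m ∧
      ∀ a : ℝ, 0 < a → ENNReal.ofReal a < minimalityIndex m →
        ∀ S : Set (ℂ × ℕ), S.Finite →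
          IsMinimalSystem (evaluatorSystem a (multisetIndices m ∪ S)) ∧
            ¬ IsCompleteSystem (evaluatorSystem a (multisetIndices m ∪ S)) := by
  refine ⟨le_antisymm (sSup_le ?_) (le_of_forall_lt fun x hx => ?_), fun a ha hlt S hS => ?_⟩
  · rintro _ ⟨b, ⟨hb, hmin⟩, rfl⟩
    refine le_sInf ?_
    rintro _ ⟨a, ⟨ha, hcomp⟩, rfl⟩
    by_contra! hab
    obtain ⟨f, hf, hf0, h⟩ := exists_le_zeroOrder_of_isMinimalSystem ha
      ((ENNReal.ofReal_lt_ofReal_iff hb).1 hab) hne hmin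
    exact not_isCompleteSystem_of_lt_zeroOrder ha hf hf0
      (fun p hp => lt_of_lt_of_le hp (h p.1)) hcomp
  · obtain ⟨r, hxr, hr⟩ := ENNReal.lt_iff_exists_nnreal_btwn.1 hx
    have hr0 : (0 : ℝ) < r := by exact_mod_cast pos_of_gt hxr
    have hnot : ¬ IsCompleteSystem (evaluatorSystem r (multisetIndices m)) := fun h =>
      hr.not_ge (sInf_le ⟨r, ⟨hr0, h⟩, ENNReal.ofReal_coe_nnreal⟩)
    obtain ⟨f, hf, hf0, h⟩ := exists_le_zeroOrder_of_not_isCompleteSystem hr0 hnot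
    exact hxr.trans_le (le_sSup ⟨r, ⟨hr0, isMinimalSystem_of_lt_zeroOrder hr0 hf hf0
      fun p hp => lt_of_lt_of_le hp (h p.1)⟩, ENNReal.ofReal_coe_nnreal⟩)
  · obtain ⟨_, ⟨b, ⟨hb, hmin⟩, rfl⟩, hab⟩ := lt_sSup_iff.1 hlt
    obtain ⟨c, hac, hcb⟩ := exists_between ((ENNReal.ofReal_lt_ofReal_iff hb).1 hab)
    obtain ⟨f, hf, hf0, h⟩ := exists_le_zeroOrder_of_isMinimalSystem (ha.trans hac) hcb hne hmin
    obtain ⟨g, hg, hg0, h1, h2⟩ := exists_lt_zeroOrder_of_finite ha hac hf hf0 hS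
    have hI : ∀ p ∈ multisetIndices m ∪ S, p.2 < zeroOrder g p.1 := by
      rintro p (hp | hp)
      · exact lt_of_lt_of_le hp ((h p.1).trans (h2 p.1))
      · exact h1 p hp
    exact ⟨isMinimalSystem_of_lt_zeroOrder ha hg hg0 hI,
      not_isCompleteSystem_of_lt_zeroOrder ha hg hg0 hI⟩
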